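/- Let $G$ be a compact group with normalized Haar measure $dg$, let $R$ be a continuous unitary representation of $G$ on $V=\mathbb C^{\iota}$ with finite computational basis $|x\rangle$, $x\in\iota$, and write $\bar R$ for the complex conjugate representation. For each class $\lambda$ in the unitary dual $\hat G$ fix a representative $R_\lambda$ on $V_\lambda=\mathbb C^{d_\lambda}$. A Clebsch–Gordan transform (CG) for $R$ consists of multiplicities $m_{\lambda,\nu}$ and tensors $C^{\lambda,\nu,i}:V_\lambda\otimes V\to V_\nu$, $1\le i\le m_{\lambda,\nu}$, which for every $\lambda\in\hat G$ form a unitary intertwiner $R_\lambda\otimes R\simeq\bigoplus_\nu R_\nu\otimes 1_{m_{\lambda,\nu}}$. A dual transform (dCG) of $C$ is a Clebsch–Gordan transform for $\bar R$ with multiplicities $m_{\nu,\lambda}$ and tensors $D^{\lambda,\nu,i}:V_\lambda\otimes\bar V\to V_\nu$, $1\le i\le m_{\nu,\lambda}$, such that $D^{\lambda,\nu,i}_{M',Mx}$ is a positive multiple (depending only on $\lambda,\nu,i$) of $\overline{C^{\nu,\lambda,i}_{M,M'x}}$. The memory is the Hilbert space with orthonormal basis $|\lambda,M,\bar M\rangle$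 ($\lambda\in\hat G$; $M,\bar M\in[d_\lambda]$, with $\bar M$ labelling the basis of $\overline{V_\lambda}$), and $|\varnothing\rangle$ is its basis vector with $\lambda$ trivial. The compressed oracles act on memory $\otimes\,V$ and send $|\lambda,M,\bar M\rangle|x\rangle$ to $|\nu,M',\bar M'\rangle|y\rangle$ with amplitudes $$\begin{aligned}\text{forward } f\mathcal O:&\ \textstyle\sum_i C^{\lambda,\nu,i}_{M',Mx}\,D^{\nu,\lambda,i}_{\bar M,\bar M'y},&\text{conjugate } c\mathcal O:&\ \textstyle\sum_i D^{\lambda,\nu,i}_{M',Mx}\,C^{\nu,\lambda,i}_{\bar M,\bar M'y},\\ \text{transpose } t\mathcal O:&\ \textstyle\sum_i \overline{C^{\lambda,\nu,i}_{\bar M',\bar Mx}}\;\overline{D^{\nu,\lambda,i}_{M,M'y}},&\text{inverse } i\mathcal O:&\ \textstyle\sum_i \overline{D^{\lambda,\nu,i}_{\bar M',\bar Mx}}\;\overline{C^{\nu,\lambda,i}_{M,M'y}},\end{aligned}$$ that is, $f\mathcal O$ is a CG transform on the registers $M,x$ followed by an inverse dCG transform (in its complex conjugate form) on $\bar M$ and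 the output; the others arise by exchanging CG and dCG and/or exchanging the roles of $M$ and $\bar M$. Then a Clebsch–Gordan transform $C$ for $R$ exists; every $C$ has exactly one dual transform $D$; and there are unique unitary operators $f\mathcal O,c\mathcal O,t\mathcal O,i\mathcal O$ with the above matrix elements. Moreover let $n\ge0$, let $q=(q_1,\dots,q_n)$ be any sequence of query types, and let $\mathcal O^{(k)}$ be the oracle of type $q_k$, $\mathcal O^{(k)}_{(y,x)}=(I\otimes\langle y|)\mathcal O^{(k)}(I\otimes|x\rangle)$ and $\mathcal O^{(k)\dagger}_{(x,y)}=(I\otimes\langle x|)\mathcal O^{(k)\dagger}(I\otimes|y\rangle)$. Put $R^{(k)}=R$ if $q_k$ is forward or transpose and $R^{(k)}=\bar R$ otherwise. 1. The compositions $W^\lambda_T:\mathbb{C}^{\iota^n}\to V_\lambda$ of CG and dCG tensors along paths $T=(T_0,t_1,T_1,\dots,t_n,T_n)$ from the trivial irrep to $T_n=\lambda$ (using $C$ at step $k$ if $R^{(k)}=R$ and $D$ if $R^{(k)}=\bar R$) form a unitary intertwiner $\bigotimes_kR^{(k)}\simeq\bigoplus_\lambda R_\lambda\otimes 1_{B(\lambda)}$,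 where $B(\lambda)$ is the (finite) set of these paths; the operators $E^\lambda_{T,S}=(W^\lambda_T)^\dagger W^\lambda_S$ are matrix units spanning the commutant of $\bigotimes_kR^{(k)}$. (For forward queries this is the commutant of $R^{\otimes n}$.) 2. For these $E^\lambda_{T,S}$, and also for the matrix units defined by any other unitary decomposition $\bigotimes_kR^{(k)}\simeq\bigoplus_\lambda R_\lambda\otimes 1_{B(\lambda)}$, and for all $x,y,\hat x,\hat y\in\iota^n$, $$\mathrm{Tr}\Big[\mathcal O^{(n)}_{(y_n,x_n)}\cdots\mathcal O^{(1)}_{(y_1,x_1)}|\varnothing\rangle\langle\varnothing|\mathcal O^{(1)\dagger}_{(\hat x_1,\hat y_1)}\cdots\mathcal O^{(n)\dagger}_{(\hat x_n,\hat y_n)}\Big]=\sum_{\lambda}\frac1{d_\lambda}\sum_{T,S\in B(\lambda)}\langle\hat a|E^\lambda_{T,S}|a\rangle\,\overline{\langle\hat b|E^\lambda_{T,S}|b\rangle},$$ where $(a_k,b_k)=(x_k,y_k)$, $(\hat a_k,\hat b_k)=(\hat x_k,\hat y_k)$ if $q_k$ is forward or conjugate, and $(a_k,b_k)=(y_k,x_k)$,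 $(\hat a_k,\hat b_k)=(\hat y_k,\hat x_k)$ if $q_k$ is transpose or inverse. In particular for $n$ forward queries the right side is $\sum_\lambda\frac1{d_\lambda}\sum_{T,S}\langle\hat x|E^\lambda_{T,S}|x\rangle\overline{\langle\hat y|E^\lambda_{T,S}|y\rangle}$. If all matrix entries of the $E^\lambda_{T,S}$ are real, the complex conjugation may be omitted. 3. The same trace equals the Haar average $$\int_G\prod_{k}Q_k(R(g))_{y_k,x_k}\ \prod_k\big(Q_k(R(g))^\dagger\big)_{\hat x_k,\hat y_k}\,dg,$$ where $Q_k(U)$ is $U$, $\bar U$, $U^{\mathsf T}$ or $U^\dagger$ according to whether $q_k$ is forward, conjugate, transpose or inverse. -/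

import Mathlib

open MeasureTheory
open scoped Matrix Kronecker ComplexConjugate InnerProductSpace

noncomputable section

namespace CompressedOracle

universe u v w

/-! ### Irreducible representations of a topological group -/

/-- The linear representation on `ι → ℂ` given by a group homomorphism into unitary matrices. -/
def toRep {G : Type u} [Group G] {ι : Type v} [Fintype ι] [DecidableEq ι]
    (ρ : G →* Matrix.unitaryGroup ι ℂ) : Representation ℂ G (ι → ℂ) :=
  ((Matrix.toLinAlgEquiv' : Matrix ι ι ℂ ≃ₐ[ℂ] _) : Matrix ι ι ℂ →* ((ι → ℂ) →ₗ[ℂ] (ι → ℂ))).comp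
    ((Matrix.unitaryGroup ι ℂ).subtype.comp ρ)

/-- A continuous irreducible unitary representation, written in an orthonormal basis. -/
structure UnitaryIrrep (G : Type u) [Group G] [TopologicalSpace G] where
  dim : ℕ
  rep : G →* Matrix.unitaryGroup (Fin dim) ℂ
  continuous_rep : Continuous fun g => (rep g : Matrix (Fin dim) (Fin dim) ℂ)
  irreducible : (toRep rep).IsIrreducible

section

variable {G : Type u} [Group G] [TopologicalSpace G]

theorem UnitaryIrrep.dim_pos (p : UnitaryIrrep G) : 0 < p.dim := by
  rcases Nat.eq_zero_or_pos p.dim with h | h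
  · exfalso
    have hi : (toRep p.rep).IsIrreducible := p.irreducible
    obtain ⟨a, b, hab⟩ := hi.toNontrivial
    apply hab
    have : IsEmpty (Fin p.dim) := by rw [h]; infer_instance
    have hs : Subsingleton (Submodule ℂ (Fin p.dim → ℂ)) := inferInstance
    exact Subrepresentation.toSubmodule_injective (Subsingleton.elim _ _)
  · exact h

/-- Unitary equivalence of unitary representations. -/
def UnitaryIrrep.Equivalent (p q : UnitaryIrrep G) : Prop :=
  ∃ U : Matrix (Fin p.dim) (Fin q.dim) ℂ, Uᴴ * U = 1 ∧ U * Uᴴ = 1 ∧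
    ∀ g, U * (q.rep g : Matrix (Fin q.dim) (Fin q.dim) ℂ)
      = (p.rep g : Matrix (Fin p.dim) (Fin p.dim) ℂ) * U

instance irrepSetoid (G : Type u) [Group G] [TopologicalSpace G] : Setoid (UnitaryIrrep G) where
  r := UnitaryIrrep.Equivalent
  iseqv :=
    { refl := fun p => ⟨1, by simp, by simp, by simp⟩
      symm := by
        rintro p q ⟨U, h1, h2, h3⟩
        refine ⟨Uᴴ, by simpa using h2, by simpa using h1, fun g => ?_⟩
        have h := congrArg (fun X : Matrix (Fin p.dim) (Fin q.dim) ℂ => Uᴴ * X * Uᴴ) (h3 g)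
        simp only [Matrix.mul_assoc, h2, Matrix.mul_one] at h
        rw [← Matrix.mul_assoc, h1, Matrix.one_mul] at h
        exact h.symm
      trans := by
        rintro p q r ⟨U, h1, h2, h3⟩ ⟨V, k1, k2, k3⟩
        refine ⟨U * V, ?_, ?_, fun g => ?_⟩
        · rw [Matrix.conjTranspose_mul, Matrix.mul_assoc, ← Matrix.mul_assoc Uᴴ, h1,
            Matrix.one_mul, k1]
        · rw [Matrix.conjTranspose_mul, Matrix.mul_assoc, ← Matrix.mul_assoc V, k2,
            Matrix.one_mul, h2]
        · rw [Matrix.mul_assoc, k3, ← Matrix.mul_assoc, h3, Matrix.mul_assoc] }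

/-- The unitary dual `Ĝ`: equivalence classes of continuous irreducible unitary representations. -/
def UDual (G : Type u) [Group G] [TopologicalSpace G] : Type u := Quotient (irrepSetoid G)

def UDual.mk (p : UnitaryIrrep G) : UDual G := Quotient.mk (irrepSetoid G) p

/-- The trivial representation. -/
def trivialIrrep (G : Type u) [Group G] [TopologicalSpace G] : UnitaryIrrep G where
  dim := 1
  rep := 1
  continuous_rep := continuous_const
  irreducible := by
    have hs : IsSimpleModule ℂ (Fin 1 → ℂ) := isSimpleModule_iff_finrank_eq_one.2 (by simp)
    have ho : IsSimpleOrder (Submodule ℂ (Fin 1 → ℂ)) := (isSimpleModule_iff _ _).1 hs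
    refine { exists_pair_ne := ⟨⊥, ⊤, fun h => ?_⟩, eq_bot_or_eq_top := fun a => ?_ }
    · exact bot_ne_top (α := Submodule ℂ (Fin 1 → ℂ))
        (congrArg Subrepresentation.toSubmodule h)
    · rcases ho.eq_bot_or_eq_top a.toSubmodule with h | h
      · exact Or.inl (Subrepresentation.toSubmodule_injective h)
      · exact Or.inr (Subrepresentation.toSubmodule_injective h)

/-- The label of the trivial representation. -/
def triv (G : Type u) [Group G] [TopologicalSpace G] : UDual G := UDual.mk (trivialIrrep G)

/-- A choice, for every label in `Ĝ`, of a representative together with an orthonormal basis of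
its space. -/
structure IrrepBasis (G : Type u) [Group G] [TopologicalSpace G] where
  irrep : UDual G → UnitaryIrrep G
  mk_irrep : ∀ l, UDual.mk (irrep l) = l

namespace IrrepBasis

/-- The dimension `d_l` of the irrep `l`. -/
def d (σ : IrrepBasis G) (l : UDual G) : ℕ := (σ.irrep l).dim

/-- The matrix of the irrep `l` at a group element. -/
def mat (σ : IrrepBasis G) (l : UDual G) (g : G) : Matrix (Fin (σ.d l)) (Fin (σ.d l)) ℂ :=
  ((σ.irrep l).rep g : Matrix (Fin (σ.irrep l).dim) (Fin (σ.irrep l).dim) ℂ)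

theorem d_pos (σ : IrrepBasis G) (l : UDual G) : 0 < σ.d l := (σ.irrep l).dim_pos

end IrrepBasis

/-! ### Unitary decompositions into irreps -/

/-- `W` is (the family of blocks of) a unitary intertwiner
`ℂ^κ ≃ ⨁_l V_l ⊗ M_l`, `ρ(g) ≃ ⨁_l R_l(g) ⊗ 1`, where `M_l` has an orthonormal basis labelled by the
finite set `B l`; the block `W l T` maps `ℂ^κ` onto `V_l ⊗ |T⟩`. -/
structure IsDecomposition (σ : IrrepBasis G) {κ : Type v} [Fintype κ] [DecidableEq κ]
    (ρ : G → Matrix κ κ ℂ) (B : UDual G → Type w)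
    (W : (l : UDual G) → B l → Matrix (Fin (σ.d l)) κ ℂ) : Prop where
  finite : Finite ((l : UDual G) × B l)
  intertwines : ∀ l T g, W l T * ρ g = σ.mat l g * W l T
  norm_block : ∀ l T, W l T * (W l T)ᴴ = 1
  orth_mult : ∀ l T S, T ≠ S → W l T * (W l S)ᴴ = 0
  orth_irrep : ∀ l l' T S, l ≠ l' → W l T * (W l' S)ᴴ = 0
  complete : ∑ᶠ p : (l : UDual G) × B l, (W p.1 p.2)ᴴ * W p.1 p.2 = 1

/-- The operator `E^l_{T,S} ≃ 1_{V_l} ⊗ |T⟩⟨S|`. -/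
def matUnit {σ : IrrepBasis G} {κ : Type v} {B : UDual G → Type w}
    (W : (l : UDual G) → B l → Matrix (Fin (σ.d l)) κ ℂ) (l : UDual G) (T S : B l) :
    Matrix κ κ ℂ := (W l T)ᴴ * W l S

/-- `E` is a system of (nonzero) matrix units of the commutant of `ρ`. -/
structure IsCommutantMatrixUnits {κ : Type v} [Fintype κ] (ρ : G → Matrix κ κ ℂ)
    (B : UDual G → Type w) (E : (l : UDual G) → B l → B l → Matrix κ κ ℂ) : Prop where
  ne_zero : ∀ l T S, E l T S ≠ 0
  star : ∀ l T S, (E l T S)ᴴ = E l S T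
  mul_same : ∀ l T S U, E l T S * E l S U = E l T U
  mul_ne : ∀ l T S S' U, S ≠ S' → E l T S * E l S' U = 0
  mul_irrep : ∀ l l' T S T' S', l ≠ l' → E l T S * E l' T' S' = 0
  span : (Submodule.span ℂ {X | ∃ l T S, X = E l T S} : Set (Matrix κ κ ℂ))
    = {X | ∀ g, X * ρ g = ρ g * X}

/-! ### Clebsch–Gordan transforms -/

variable {ι : Type v} [Fintype ι] [DecidableEq ι]

/-- The complex conjugate representation, as a matrix-valued function. -/
def conjRep (R : G →* Matrix.unitaryGroup ι ℂ) (g : G) : Matrix ι ι ℂ :=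
  ((R g : Matrix ι ι ℂ)).map star

/-- Families of Clebsch–Gordan tensors: for irreps `l`, `l'` and a multiplicity label `i` (there are
`m l l'` of them), the matrix of a map `V_l ⊗ V → V_{l'}`. -/
abbrev CGTensor (σ : IrrepBasis G) (ι : Type v) (m : UDual G → UDual G → ℕ) :=
  (l l' : UDual G) → Fin (m l l') → Matrix (Fin (σ.d l')) (Fin (σ.d l) × ι) ℂ

/-- `C` is a Clebsch–Gordan transform for tensoring with `ρ`: for every irrep `l` it is a unitary
intertwiner `R_l ⊗ ρ ≃ ⨁_{l'} R_{l'} ⊗ 1_{m l l'}`. -/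
def IsCG (σ : IrrepBasis G) (ρ : G → Matrix ι ι ℂ) (m : UDual G → UDual G → ℕ)
    (C : CGTensor σ ι m) : Prop :=
  ∀ l, IsDecomposition σ (fun g => σ.mat l g ⊗ₖ ρ g) (fun l' => Fin (m l l')) (C l)

/-- `D` is the dual Clebsch–Gordan transform belonging to `C`: a Clebsch–Gordan transform for
tensoring with the conjugate of `R`, whose multiplicity basis and phases are matched with those of
`C`, i.e. each tensor `D l l' i : V_l ⊗ V̄ → V_{l'}` is a positive multiple of the tensor
obtained from `C l' l i : V_{l'} ⊗ V → V_l` by taking the adjoint and bending the wire `V`. -/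
structure IsDualCG (σ : IrrepBasis G) (R : G →* Matrix.unitaryGroup ι ℂ)
    {m : UDual G → UDual G → ℕ} (C : CGTensor σ ι m)
    (D : CGTensor σ ι fun l l' => m l' l) : Prop where
  isCG : IsCG σ (conjRep R) (fun l l' => m l' l) D
  matched : ∀ l l' (i : Fin (m l' l)), ∃ c : ℝ, 0 < c ∧
    ∀ M' M x, D l l' i M' (M, x) = (c : ℂ) * conj (C l' l i M (M', x))

/-! ### The four query types -/

inductive Query
  | forward
  | conjugate
  | transpose
  | inverse

/-- The operator applied by a query to `A`: `A`, `Ā`, `Aᵀ`, or `A†` (for unitary `A`, `A⁻¹`). -/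
def Query.op : Query → Matrix ι ι ℂ → Matrix ι ι ℂ
  | .forward, A => A
  | .conjugate, A => A.map star
  | .transpose, A => Aᵀ
  | .inverse, A => Aᴴ

/-- Among `R` and its conjugate, the representation whose matrix elements the query reads:
`R` for forward and transpose queries, `R̄` for conjugate and inverse ones. -/
def Query.base (R : G →* Matrix.unitaryGroup ι ℂ) : Query → G → Matrix ι ι ℂ
  | .forward, g => R g
  | .conjugate, g => conjRep R g
  | .transpose, g => R g
  | .inverse, g => conjRep R g

/-- The column index of `Query.base` which is read when the query has input `x`, output `y`. -/
def Query.col : Query → ι → ι → ι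
  | .forward, x, _ => x
  | .conjugate, x, _ => x
  | .transpose, _, y => y
  | .inverse, _, y => y

/-- The row index of `Query.base` which is read when the query has input `x`, output `y`. -/
def Query.row : Query → ι → ι → ι
  | .forward, _, y => y
  | .conjugate, _, y => y
  | .transpose, x, _ => x
  | .inverse, x, _ => x

/-- The representation `g ↦ ⨂_k R^{(k)}(g)`, with `R^{(k)}` equal to `R` or `R̄` according to
the `k`-th query; it is `R^{⊗n}` when all queries are forward. -/
def tensorRep (R : G →* Matrix.unitaryGroup ι ℂ) {n : ℕ} (q : Fin n → Query) (g : G) :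
    Matrix (Fin n → ι) (Fin n → ι) ℂ :=
  Matrix.of fun a b => ∏ k, (q k).base R g (a k) (b k)

/-! ### Paths of irreps -/

/-- Number of multiplicity labels for a step from `l` to `l'`. -/
def stepMult (m : UDual G → UDual G → ℕ) : Query → UDual G → UDual G → ℕ
  | .forward, l, l' => m l l'
  | .conjugate, l, l' => m l' l
  | .transpose, l, l' => m l l'
  | .inverse, l, l' => m l' l

/-- The tensor `V_l ⊗ V → V_{l'}` or `V_l ⊗ V̄ → V_{l'}` of a step from `l` to `l'`. -/
def stepTensor {σ : IrrepBasis G} {m : UDual G → UDual G → ℕ} (C : CGTensor σ ι m)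
    (D : CGTensor σ ι fun l l' => m l' l) :
    (q : Query) → CGTensor σ ι (stepMult m q)
  | .forward => C
  | .conjugate => D
  | .transpose => C
  | .inverse => D

/-- `B(l)`: paths `(T_0, t_1, T_1, …, t_n, T_n)` of irreps with multiplicity labels, starting at the
trivial irrep `T_0` and ending at `T_n = l`. -/
def IrrepPath (m : UDual G → UDual G → ℕ) : (n : ℕ) → (Fin n → Query) → UDual G → Type u
  | 0, _, l => ULift (PLift (l = triv G))
  | n + 1, q, l' =>
      (l : UDual G) × (IrrepPath m n (Fin.init q) l × Fin (stepMult m (q (Fin.last n)) l l'))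

/-- The concatenation of the Clebsch–Gordan tensors along a path, a map
`⨂_k V^{(k)} → V_l`. -/
def pathTensor {σ : IrrepBasis G} {m : UDual G → UDual G → ℕ} (C : CGTensor σ ι m)
    (D : CGTensor σ ι fun l l' => m l' l) :
    (n : ℕ) → (q : Fin n → Query) → (l : UDual G) → IrrepPath m n q l →
      Matrix (Fin (σ.d l)) (Fin n → ι) ℂ
  | 0, _, _, _ => Matrix.of fun _ _ => 1
  | n + 1, q, l', T => Matrix.of fun M' x =>
      ∑ M : Fin (σ.d T.1), stepTensor C D (q (Fin.last n)) T.1 l' T.2.2 M' (M, x (Fin.last n)) *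
        pathTensor C D n (Fin.init q) T.1 T.2.1 M (Fin.init x)

/-! ### The compressed oracles -/

/-- Basis states `|l, M, M̄⟩` of the memory `⨁_l V_l ⊗ V̄_l`: an irrep label `l`, a basis label of
`V_l` and a basis label of its conjugate. -/
abbrev MemIdx (σ : IrrepBasis G) := (l : UDual G) × (Fin (σ.d l) × Fin (σ.d l))

/-- The memory Hilbert space. -/
abbrev Mem (σ : IrrepBasis G) := lp (fun _ : MemIdx σ => ℂ) 2

/-- The Hilbert space (working register) ⊗ (memory), as the direct sum of copies of the memory over
the basis states of the working register. -/
abbrev Joint (σ : IrrepBasis G) (ι : Type v) [Fintype ι] := PiLp 2 fun _ : ι => Mem σ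

/-- The basis vector `|l, M, M̄⟩` of the memory. -/
def ket {σ : IrrepBasis G} (a : MemIdx σ) : Mem σ :=
  letI := Classical.decEq (MemIdx σ)
  lp.single 2 a 1

/-- The initial memory state `|∅⟩`: the basis vector of the trivial irrep. -/
def vacuum (σ : IrrepBasis G) : Mem σ :=
  ket ⟨triv G, ⟨0, σ.d_pos _⟩, ⟨0, σ.d_pos _⟩⟩

/-- Matrix element of the compressed oracles from `|l, M, M̄⟩|x⟩` to `|l', M', M̄'⟩|y⟩`.

* forward: the transform `C` acts on the registers `M, x`, and produces `l'`, a multiplicity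
  label `i` and `M'`; then the inverse of the dual transform (in its conjugate form, decomposing
  `V̄_{l'} ⊗ V` into the spaces `V̄_l`) turns `l`, `i`, `M̄` into `M̄'` and the output `y`;
* conjugate: the same circuit with `C` and `D` exchanged;
* transpose, inverse: the two previous circuits with the roles of `V_l` and `V̄_l` exchanged, so
  that the first gate acts on `M̄, x` and the second one on `M`. -/
def kernel {σ : IrrepBasis G} {m : UDual G → UDual G → ℕ} (C : CGTensor σ ι m)
    (D : CGTensor σ ι fun l l' => m l' l) :
    Query → MemIdx σ → ι → MemIdx σ → ι → ℂ
  | .forward, ⟨l, M, N⟩, x, ⟨l', M', N'⟩, y =>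
      ∑ i : Fin (m l l'), C l l' i M' (M, x) * D l' l i N (N', y)
  | .conjugate, ⟨l, M, N⟩, x, ⟨l', M', N'⟩, y =>
      ∑ i : Fin (m l' l), D l l' i M' (M, x) * C l' l i N (N', y)
  | .transpose, ⟨l, M, N⟩, x, ⟨l', M', N'⟩, y =>
      ∑ i : Fin (m l l'), conj (C l l' i N' (N, x)) * conj (D l' l i M (M', y))
  | .inverse, ⟨l, M, N⟩, x, ⟨l', M', N'⟩, y =>
      ∑ i : Fin (m l' l), conj (D l l' i N' (N, x)) * conj (C l' l i M (M', y))

/-- `⟨y| ⊗ 1`, from working register ⊗ memory to the memory. -/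
def bra (σ : IrrepBasis G) (y : ι) : Joint σ ι →L[ℂ] Mem σ :=
  PiLp.proj 2 (fun _ : ι => Mem σ) y

/-- The operator `X_{(y, x)} = (1 ⊗ ⟨y|) X (1 ⊗ |x⟩)` on the memory. -/
def block {σ : IrrepBasis G} (X : Joint σ ι →L[ℂ] Joint σ ι) (y x : ι) : Mem σ →L[ℂ] Mem σ :=
  bra σ y ∘L X ∘L ContinuousLinearMap.adjoint (bra σ x)

/-- The unitary operator `O` is the compressed oracle of type `q` built from `C` and `D`. -/
def IsOracle {σ : IrrepBasis G} {m : UDual G → UDual G → ℕ} (C : CGTensor σ ι m)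
    (D : CGTensor σ ι fun l l' => m l' l) (q : Query)
    (O : unitary (Joint σ ι →L[ℂ] Joint σ ι)) : Prop :=
  ∀ (a : MemIdx σ) (x : ι) (b : MemIdx σ) (y : ι),
    ⟪ket b, block (O : Joint σ ι →L[ℂ] Joint σ ι) y x (ket a)⟫_ℂ = kernel C D q a x b y

/-- The operator
`O_{(y_n,x_n)} ⋯ O_{(y_1,x_1)} |∅⟩⟨∅| O†_{(x̂_1,ŷ_1)} ⋯ O†_{(x̂_n,ŷ_n)}` on the memory, where the
`k`-th oracle used has type `q k`. -/
def memoryOp {σ : IrrepBasis G} (O : Query → unitary (Joint σ ι →L[ℂ] Joint σ ι)) {n : ℕ}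
    (q : Fin n → Query) (x y x' y' : Fin n → ι) : Mem σ →L[ℂ] Mem σ :=
  (List.ofFn fun k => block (O (q k) : Joint σ ι →L[ℂ] Joint σ ι) (y k) (x k)).reverse.prod *
    InnerProductSpace.rankOne ℂ (vacuum σ) (vacuum σ) *
    (List.ofFn fun k =>
      block (star (O (q k)) : Joint σ ι →L[ℂ] Joint σ ι) (x' k) (y' k)).prod

/-- `t` is the trace of `X`: the sum of the diagonal matrix elements. -/
def HasTrace {σ : IrrepBasis G} (X : Mem σ →L[ℂ] Mem σ) (t : ℂ) : Prop :=
  HasSum (fun a : MemIdx σ => ⟪ket a, X (ket a)⟫_ℂ) t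

end

end CompressedOracle

end

open CompressedOracle

/-!
Bending the `V`-wire of a Clebsch–Gordan tensor `C^{λ,ν,i}` gives its dual `D^{ν,λ,i}`, with the
scale `√(d_λ / d_ν)` dictated by Schur's lemma. Hence one query multiplies the amplitude by that
scale, by a tensor `C^{λ,ν,i}` or `D^{λ,ν,i}` acting on `M`, and by the complex conjugate of the
same tensor acting on `M̄`. The scales telescope, and the memory state after the queries is
`∑_{λ,T} d_λ^{-1/2} W_T|a⟩ ⊗ conj (W_T|b⟩)`. The inner product of two such states is
`∑_λ d_λ⁻¹ ∑_{T,S} E_{T,S} ⊗ conj E_{T,S}`. Since the `d_λ^{-1/2} E_{T,S}` are an orthonormal basis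
of the commutant for the Frobenius inner product, this is the kernel of the orthogonal projection
onto the commutant. That projection is the Haar twirl, whence the independence of the decomposition
and the integral formula.
-/

noncomputable section

namespace CompressedOracle

section UnitaryRep

variable {G : Type*} {κ κ' κ'' : Type*} [Fintype κ] [Fintype κ'] [Fintype κ'']

/-- The space `Hom_G(ρ, τ)` of intertwiners between two matrix-valued functions on `G`, usually
representations. -/
def intertwiners (ρ : G → Matrix κ κ ℂ) (τ : G → Matrix κ' κ' ℂ) :
    Submodule ℂ (Matrix κ' κ ℂ) where
  carrier := {A | ∀ g, A * ρ g = τ g * A}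
  zero_mem' g := by simp
  add_mem' hA hB g := by rw [Matrix.add_mul, Matrix.mul_add, hA g, hB g]
  smul_mem' c A hA g := by rw [Matrix.smul_mul, Matrix.mul_smul, hA g]

theorem mul_mem_intertwiners {ρ : G → Matrix κ κ ℂ} {τ : G → Matrix κ' κ' ℂ}
    {υ : G → Matrix κ'' κ'' ℂ} {A : Matrix κ'' κ' ℂ} {B : Matrix κ' κ ℂ}
    (hA : A ∈ intertwiners τ υ) (hB : B ∈ intertwiners ρ τ) : A * B ∈ intertwiners ρ υ :=
  fun g => by rw [Matrix.mul_assoc, hB g, ← Matrix.mul_assoc, hA g, Matrix.mul_assoc]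

variable [Group G] [TopologicalSpace G] [DecidableEq κ]

/-- A continuous unitary representation, as a matrix-valued function. Unlike a homomorphism into
`Matrix.unitaryGroup`, this is also a predicate on tensor products and conjugates of matrices. -/
structure IsUnitaryRep (ρ : G → Matrix κ κ ℂ) : Prop where
  continuous : Continuous ρ
  map_one : ρ 1 = 1
  map_mul : ∀ g h, ρ (g * h) = ρ g * ρ h
  map_inv : ∀ g, ρ g⁻¹ = (ρ g)ᴴ

namespace IsUnitaryRep

theorem of_hom {R : G →* Matrix.unitaryGroup κ ℂ}
    (hR : Continuous fun g => (R g : Matrix κ κ ℂ)) :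
    IsUnitaryRep fun g => (R g : Matrix κ κ ℂ) where
  continuous := hR
  map_one := by simp
  map_mul g h := by simp
  map_inv g := by rw [_root_.map_inv]; rfl

variable {ρ : G → Matrix κ κ ℂ}

theorem mul_conjTranspose (hρ : IsUnitaryRep ρ) (g : G) : ρ g * (ρ g)ᴴ = 1 := by
  rw [← hρ.map_inv, ← hρ.map_mul, mul_inv_cancel, hρ.map_one]

theorem conjTranspose_mul (hρ : IsUnitaryRep ρ) (g : G) : (ρ g)ᴴ * ρ g = 1 := by
  rw [← hρ.map_inv, ← hρ.map_mul, inv_mul_cancel, hρ.map_one]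

theorem map_star (hρ : IsUnitaryRep ρ) : IsUnitaryRep fun g => (ρ g).map star where
  continuous := hρ.continuous.matrix_map continuous_star
  map_one := by rw [hρ.map_one, Matrix.map_one _ (star_zero ℂ) (star_one ℂ)]
  map_mul g h := by rw [hρ.map_mul]; exact Matrix.map_mul (f := starRingEnd ℂ)
  map_inv g := by rw [hρ.map_inv]; rfl

theorem kronecker [DecidableEq κ'] (hρ : IsUnitaryRep ρ) {τ : G → Matrix κ' κ' ℂ}
    (hτ : IsUnitaryRep τ) : IsUnitaryRep fun g => ρ g ⊗ₖ τ g where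
  continuous := continuous_matrix fun a b =>
    (hρ.continuous.matrix_elem a.1 b.1).mul (hτ.continuous.matrix_elem a.2 b.2)
  map_one := by rw [hρ.map_one, hτ.map_one, Matrix.one_kronecker_one]
  map_mul g h := by rw [hρ.map_mul, hτ.map_mul, Matrix.mul_kronecker_mul]
  map_inv g := by rw [hρ.map_inv, hτ.map_inv, Matrix.conjTranspose_kronecker]

/-- The homomorphism into the unitary group given by a unitary representation. -/
def toHom (hρ : IsUnitaryRep ρ) : G →* Matrix.unitaryGroup κ ℂ where
  toFun g := ⟨ρ g, Matrix.mem_unitaryGroup_iff.2 (hρ.mul_conjTranspose g)⟩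
  map_one' := Subtype.ext hρ.map_one
  map_mul' g h := Subtype.ext (hρ.map_mul g h)

theorem conjTranspose_mem_intertwiners [DecidableEq κ'] (hρ : IsUnitaryRep ρ)
    {τ : G → Matrix κ' κ' ℂ} (hτ : IsUnitaryRep τ) {A : Matrix κ' κ ℂ}
    (hA : A ∈ intertwiners ρ τ) : Aᴴ ∈ intertwiners τ ρ := fun g => by
  have h := congrArg Matrix.conjTranspose (hA g⁻¹)
  rw [Matrix.conjTranspose_mul, Matrix.conjTranspose_mul, hρ.map_inv, hτ.map_inv,
    Matrix.conjTranspose_conjTranspose, Matrix.conjTranspose_conjTranspose] at h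
  exact h.symm

end IsUnitaryRep

end UnitaryRep

section Schur

variable {G : Type*} [Group G]

theorem toRep_apply {κ : Type*} [Fintype κ] [DecidableEq κ] (ρ : G →* Matrix.unitaryGroup κ ℂ)
    (g : G) (v : κ → ℂ) : toRep ρ g v = (ρ g : Matrix κ κ ℂ) *ᵥ v := by
  simp [toRep]

variable [TopologicalSpace G]

theorem UnitaryIrrep.exists_eq_smul_one (p : UnitaryIrrep G)
    {A : Matrix (Fin p.dim) (Fin p.dim) ℂ} (hA : ∀ g, A * p.rep g = p.rep g * A) :
    ∃ c : ℂ, A = c • 1 := by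
  have := p.irreducible
  let f : (toRep p.rep).IntertwiningMap (toRep p.rep) :=
    (Matrix.toLin' A).intertwiningMap_of_isIntertwiningMap _ _ fun g v => by
      rw [toRep_apply, toRep_apply, Matrix.toLin'_apply, Matrix.toLin'_apply,
        Matrix.mulVec_mulVec, Matrix.mulVec_mulVec, hA g]
  obtain ⟨c, hc⟩ :=
    Representation.IsIrreducible.algebraMap_intertwiningMap_bijective_of_isAlgClosed.2 f
  refine ⟨c, Matrix.toLin'.injective <| LinearMap.ext fun v => ?_⟩
  rw [map_smul, Matrix.toLin'_one]
  exact (DFunLike.congr_fun hc v).symm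

namespace IrrepBasis

variable (σ : IrrepBasis G)

theorem isUnitaryRep (l : UDual G) : IsUnitaryRep (σ.mat l) :=
  IsUnitaryRep.of_hom (σ.irrep l).continuous_rep

theorem d_ne_zero (l : UDual G) : (σ.d l : ℂ) ≠ 0 :=
  Nat.cast_ne_zero.2 (σ.d_pos l).ne'

theorem eq_trace_smul_one {l : UDual G} {A : Matrix (Fin (σ.d l)) (Fin (σ.d l)) ℂ}
    (hA : A ∈ intertwiners (σ.mat l) (σ.mat l)) : A = ((σ.d l : ℂ)⁻¹ * A.trace) • 1 := by
  obtain ⟨c, hc⟩ : ∃ c : ℂ, A = c • 1 := (σ.irrep l).exists_eq_smul_one hA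
  rw [hc, Matrix.trace_smul, Matrix.trace_one, Fintype.card_fin, smul_eq_mul, mul_left_comm,
    inv_mul_cancel₀ (σ.d_ne_zero l), mul_one]

theorem exists_smul_mul_conjTranspose_eq_one {κ : Type*} [Fintype κ] [DecidableEq κ]
    {ρ : G → Matrix κ κ ℂ} (hρ : IsUnitaryRep ρ) {l : UDual G} {A : Matrix (Fin (σ.d l)) κ ℂ}
    (hA : A ∈ intertwiners ρ (σ.mat l)) (hA₀ : A ≠ 0) : ∃ c : ℂ, (c • A) * (c • A)ᴴ = 1 := by
  open scoped ComplexOrder in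
  have hpos : 0 < (σ.d l : ℂ)⁻¹ * (A * Aᴴ).trace :=
    mul_pos (inv_pos.2 (Nat.cast_pos.2 (σ.d_pos l)))
      ((Matrix.posSemidef_self_mul_conjTranspose A).trace_nonneg.lt_of_ne'
        (mt Matrix.trace_mul_conjTranspose_self_eq_zero_iff.1 hA₀))
  have hschur := σ.eq_trace_smul_one
    (mul_mem_intertwiners hA (hρ.conjTranspose_mem_intertwiners (σ.isUnitaryRep l) hA))
  obtain ⟨r, hr, hreq⟩ : ∃ r > (0 : ℝ), (r : ℂ) = (σ.d l : ℂ)⁻¹ * (A * Aᴴ).trace :=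
    RCLike.pos_iff_exists_ofReal.1 hpos
  have hsqrt : (Real.sqrt r : ℂ) * Real.sqrt r = r := by
    rw [← Complex.ofReal_mul, Real.mul_self_sqrt hr.le]
  refine ⟨(Real.sqrt r : ℂ)⁻¹, ?_⟩
  rw [Matrix.conjTranspose_smul, Matrix.smul_mul, Matrix.mul_smul, hschur, ← hreq, smul_smul,
    smul_smul, star_inv₀, RCLike.star_def, Complex.conj_ofReal, ← mul_inv, hsqrt,
    inv_mul_cancel₀ (Complex.ofReal_ne_zero.2 hr.ne'), one_smul]

theorem ne_zero_of_mul_conjTranspose_eq_one {κ : Type*} [Fintype κ] {l : UDual G}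
    {A : Matrix (Fin (σ.d l)) κ ℂ} (hA : A * Aᴴ = 1) : A ≠ 0 := by
  rintro rfl
  have : Nonempty (Fin (σ.d l)) := ⟨⟨0, σ.d_pos l⟩⟩
  exact zero_ne_one ((Matrix.zero_mul _).symm.trans hA)

theorem eq_zero_of_mem_intertwiners {l l' : UDual G} (hl : l ≠ l')
    {A : Matrix (Fin (σ.d l)) (Fin (σ.d l')) ℂ} (hA : A ∈ intertwiners (σ.mat l') (σ.mat l)) :
    A = 0 := by
  by_contra hA₀
  obtain ⟨c, hc⟩ := σ.exists_smul_mul_conjTranspose_eq_one (σ.isUnitaryRep l') hA hA₀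
  have hU := (intertwiners (σ.mat l') (σ.mat l)).smul_mem c hA
  set U := c • A
  have hUU := σ.eq_trace_smul_one (mul_mem_intertwiners
    ((σ.isUnitaryRep l').conjTranspose_mem_intertwiners (σ.isUnitaryRep l) hU) hU)
  set s := (σ.d l' : ℂ)⁻¹ * (Uᴴ * U).trace
  have hs : s • U = (1 : ℂ) • U := by
    calc s • U = U * (Uᴴ * U) := by rw [hUU, Matrix.mul_smul, Matrix.mul_one]
      _ = (1 : ℂ) • U := by rw [← Matrix.mul_assoc, hc, Matrix.one_mul, one_smul]
  rw [smul_left_injective ℂ (σ.ne_zero_of_mul_conjTranspose_eq_one hc) hs, one_smul] at hUU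
  have hequiv : (σ.irrep l).Equivalent (σ.irrep l') := ⟨U, hUU, hc, hU⟩
  apply hl
  rw [← σ.mk_irrep l, ← σ.mk_irrep l']
  exact Quotient.sound hequiv

end IrrepBasis

end Schur

section Subrepresentations

variable {κ κ' : Type*} [Fintype κ] [Fintype κ'] [DecidableEq κ']

theorem exists_isometry_range_eq (S : Submodule ℂ (κ → ℂ)) :
    ∃ (k : ℕ) (B : Matrix κ (Fin k) ℂ), Bᴴ * B = 1 ∧ LinearMap.range B.mulVecLin = S := by
  let e := (WithLp.linearEquiv 2 ℂ (κ → ℂ)).symm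
  let S' : Submodule ℂ (EuclideanSpace ℂ κ) := S.map e.toLinearMap
  let b := stdOrthonormalBasis ℂ S'
  refine ⟨_, Matrix.of fun k i => (b i : EuclideanSpace ℂ κ) k, ?_, ?_⟩
  · ext i j
    rw [Matrix.one_apply, ← orthonormal_iff_ite.1 b.orthonormal i j, Submodule.coe_inner,
      EuclideanSpace.inner_eq_star_dotProduct, dotProduct_comm]
    rfl
  · have hb : Submodule.span ℂ (Set.range fun i => (b i : EuclideanSpace ℂ κ)) = S' := by
      rw [Set.range_comp', ← Submodule.coe_subtype, Submodule.span_image, ← b.coe_toBasis,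
        b.toBasis.span_eq, Submodule.map_top, Submodule.range_subtype]
    have hS : S = S'.map e.symm.toLinearMap := by
      rw [← Submodule.map_comp, LinearEquiv.symm_comp, Submodule.map_id]
    rw [Matrix.range_mulVecLin]
    refine Eq.trans ?_ ((congrArg (Submodule.map e.symm.toLinearMap) hb).trans hS.symm)
    rw [Submodule.map_span, ← Set.range_comp]
    rfl

theorem mul_conjTranspose_mulVec_of_mem_range {B : Matrix κ κ' ℂ} (hB : Bᴴ * B = 1) {v : κ → ℂ}
    (hv : v ∈ LinearMap.range B.mulVecLin) : (B * Bᴴ) *ᵥ v = v := by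
  obtain ⟨w, rfl⟩ := hv
  rw [Matrix.mulVecLin_apply, Matrix.mulVec_mulVec, Matrix.mul_assoc, hB, Matrix.mul_one]

namespace IsUnitaryRep

variable {G : Type*} [Group G] [TopologicalSpace G] [DecidableEq κ] {ρ : G → Matrix κ κ ℂ}

theorem compress (hρ : IsUnitaryRep ρ) {B : Matrix κ κ' ℂ} (hB : Bᴴ * B = 1)
    (hBρ : B ∈ intertwiners (fun g => Bᴴ * ρ g * B) ρ) :
    IsUnitaryRep fun g => Bᴴ * ρ g * B where
  continuous := (continuous_const.matrix_mul hρ.continuous).matrix_mul continuous_const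
  map_one := by rw [hρ.map_one, Matrix.mul_one, hB]
  map_mul g h := by
    rw [hρ.map_mul, ← Matrix.mul_assoc Bᴴ, Matrix.mul_assoc, ← hBρ h, Matrix.mul_assoc,
      ← Matrix.mul_assoc]
    rw [Matrix.mul_assoc, Matrix.mul_assoc, Matrix.mul_assoc]
  map_inv g := by
    rw [hρ.map_inv, Matrix.conjTranspose_mul, Matrix.conjTranspose_mul,
      Matrix.conjTranspose_conjTranspose, Matrix.mul_assoc]

theorem exists_subrep (hρ : IsUnitaryRep ρ) {S : Submodule ℂ (κ → ℂ)}
    (hS : ∀ g, ∀ v ∈ S, ρ g *ᵥ v ∈ S) :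
    ∃ (k : ℕ) (τ : G → Matrix (Fin k) (Fin k) ℂ) (B : Matrix κ (Fin k) ℂ), IsUnitaryRep τ ∧
      B ∈ intertwiners τ ρ ∧ Bᴴ * B = 1 ∧ LinearMap.range B.mulVecLin = S := by
  obtain ⟨k, B, hB, rfl⟩ := exists_isometry_range_eq S
  have hBρ : B ∈ intertwiners (fun g => Bᴴ * ρ g * B) ρ := fun g => by
    refine Matrix.ext_of_mulVec_single fun i => ?_
    have := mul_conjTranspose_mulVec_of_mem_range hB (hS g _ ⟨Pi.single i 1, rfl⟩)
    simpa only [Matrix.mulVecLin_apply, Matrix.mulVec_mulVec, Matrix.mul_assoc] using this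
  exact ⟨k, _, B, hρ.compress hB hBρ, hBρ, hB, rfl⟩

theorem isIrreducible [Nonempty κ] (hρ : IsUnitaryRep ρ)
    (h : ∀ S : Submodule ℂ (κ → ℂ), (∀ g, ∀ v ∈ S, ρ g *ᵥ v ∈ S) → S = ⊥ ∨ S = ⊤) :
    (toRep hρ.toHom).IsIrreducible where
  exists_pair_ne := ⟨⊥, ⊤, fun hbt => bot_ne_top (α := Submodule ℂ (κ → ℂ))
    (congrArg Subrepresentation.toSubmodule hbt)⟩
  eq_bot_or_eq_top a :=
    (h a.toSubmodule fun g v hv => by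
      have := a.apply_mem_toSubmodule g hv
      rwa [toRep_apply] at this).imp
      (fun ha => Subrepresentation.toSubmodule_injective ha)
      fun ha => Subrepresentation.toSubmodule_injective ha

theorem exists_mem_intertwiners_ne_zero_of_isIrreducible (σ : IrrepBasis G) {k : ℕ}
    {ρ : G → Matrix (Fin k) (Fin k) ℂ} (hρ : IsUnitaryRep ρ)
    (hirr : (toRep hρ.toHom).IsIrreducible) :
    ∃ l, ∃ A ∈ intertwiners ρ (σ.mat l), A ≠ 0 := by
  let p : UnitaryIrrep G := ⟨k, hρ.toHom, hρ.continuous, hirr⟩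
  obtain ⟨U, -, hU, hUρ⟩ : (σ.irrep (UDual.mk p)).Equivalent p :=
    Quotient.exact (σ.mk_irrep (UDual.mk p))
  exact ⟨UDual.mk p, U, hUρ, σ.ne_zero_of_mul_conjTranspose_eq_one hU⟩

theorem exists_mem_intertwiners_ne_zero (σ : IrrepBasis G) {k : ℕ} (hk : 0 < k)
    {ρ : G → Matrix (Fin k) (Fin k) ℂ} (hρ : IsUnitaryRep ρ) :
    ∃ l, ∃ A ∈ intertwiners ρ (σ.mat l), A ≠ 0 := by
  induction k using Nat.strong_induction_on with
  | _ k ih =>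
    have : Nonempty (Fin k) := ⟨⟨0, hk⟩⟩
    by_cases hirr : ∀ S : Submodule ℂ (Fin k → ℂ),
        (∀ g, ∀ v ∈ S, ρ g *ᵥ v ∈ S) → S = ⊥ ∨ S = ⊤
    · exact hρ.exists_mem_intertwiners_ne_zero_of_isIrreducible σ (hρ.isIrreducible hirr)
    push Not at hirr
    obtain ⟨S, hS, hbot, htop⟩ := hirr
    obtain ⟨j, τ, B, hτ, hBτ, hB, rfl⟩ := hρ.exists_subrep hS
    have hinj : Function.Injective B.mulVecLin := fun v w hvw => by
      simpa only [Matrix.mulVecLin_apply, Matrix.mulVec_mulVec, hB, Matrix.one_mulVec]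
        using congrArg (Bᴴ *ᵥ ·) hvw
    have hrank := LinearMap.finrank_range_of_inj hinj
    rw [Module.finrank_fin_fun] at hrank
    obtain ⟨l, A, hA, hA₀⟩ := ih j
      (by simpa [hrank] using Submodule.finrank_lt htop)
      (by rw [← hrank]; exact Submodule.one_le_finrank_iff.2 hbot) hτ
    refine ⟨l, A * Bᴴ, mul_mem_intertwiners hA (hτ.conjTranspose_mem_intertwiners hρ hBτ),
      fun h => hA₀ ?_⟩
    rw [← A.mul_one, ← hB, ← Matrix.mul_assoc, h, Matrix.zero_mul]

theorem exists_mem_intertwiners_mulVec_ne_zero (σ : IrrepBasis G) (hρ : IsUnitaryRep ρ)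
    {S : Submodule ℂ (κ → ℂ)} (hS : ∀ g, ∀ v ∈ S, ρ g *ᵥ v ∈ S) (hbot : S ≠ ⊥) :
    ∃ l, ∃ A ∈ intertwiners ρ (σ.mat l), ∃ v ∈ S, A *ᵥ v ≠ 0 := by
  obtain ⟨k, τ, B, hτ, hBτ, hB, rfl⟩ := hρ.exists_subrep hS
  have hk : 0 < k := by
    refine Nat.pos_of_ne_zero fun hk => hbot ?_
    subst hk
    rw [LinearMap.range_eq_bot]
    exact LinearMap.ext fun v => by rw [Subsingleton.elim v 0, map_zero, map_zero]
  obtain ⟨l, A, hA, hA₀⟩ := hτ.exists_mem_intertwiners_ne_zero σ hk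
  obtain ⟨v, hv⟩ : ∃ v, A *ᵥ v ≠ 0 := by
    by_contra! h
    exact hA₀ (Matrix.ext_of_mulVec_single fun i => by rw [h, Matrix.zero_mulVec])
  refine ⟨l, A * Bᴴ, mul_mem_intertwiners hA (hτ.conjTranspose_mem_intertwiners hρ hBτ),
    B *ᵥ v, ⟨v, rfl⟩, ?_⟩
  rwa [Matrix.mulVec_mulVec, Matrix.mul_assoc, hB, Matrix.mul_one]

end IsUnitaryRep

end Subrepresentations

section Finsum

variable {α M : Type*} [AddCommMonoid M]

theorem exists_finset_isEmpty {B : α → Type*} (h : Finite ((l : α) × B l)) :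
    ∃ L : Finset α, ∀ l ∉ L, IsEmpty (B l) := by
  have hf := Set.finite_range (Sigma.fst : ((l : α) × B l) → α)
  refine ⟨hf.toFinset, fun l hl => ⟨fun T => hl ?_⟩⟩
  rw [Set.Finite.mem_toFinset]
  exact ⟨⟨l, T⟩, rfl⟩

theorem finsum_sigma_eq_sum {B : α → Type*} [∀ l, Fintype (B l)] {L : Finset α}
    (hL : ∀ l ∉ L, IsEmpty (B l)) (f : ((l : α) × B l) → M) :
    ∑ᶠ p, f p = ∑ l ∈ L, ∑ T, f ⟨l, T⟩ := by
  rw [finsum_eq_sum_of_support_subset (s := L.sigma fun _ => Finset.univ), Finset.sum_sigma]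
  rintro ⟨l, T⟩ -
  simp only [Finset.coe_sigma, Finset.coe_univ, Set.mem_sigma_iff, Finset.mem_coe, Set.mem_univ,
    and_true]
  by_contra hl
  exact (hL l hl).elim T

theorem finsum_eq_sum_of_forall_notMem {L : Finset α} {f : α → M} (hL : ∀ l ∉ L, f l = 0) :
    ∑ᶠ l, f l = ∑ l ∈ L, f l :=
  finsum_eq_sum_of_support_subset f fun l hl => by
    by_contra h
    exact hl (hL l h)

end Finsum

section Decompositions

variable {G : Type*} [Group G] [TopologicalSpace G] {σ : IrrepBasis G} {κ : Type*} [Fintype κ]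
  [DecidableEq κ] {ρ : G → Matrix κ κ ℂ} {B : UDual G → Type*}
  {W : (l : UDual G) → B l → Matrix (Fin (σ.d l)) κ ℂ}

namespace IsDecomposition

theorem of_orthogonal (hfin : Finite ((l : UDual G) × B l))
    (hint : ∀ l T, W l T ∈ intertwiners ρ (σ.mat l)) (hnorm : ∀ l T, W l T * (W l T)ᴴ = 1)
    (horth : ∀ p q : (l : UDual G) × B l, p ≠ q → W p.1 p.2 * (W q.1 q.2)ᴴ = 0)
    (hcomplete : ∑ᶠ p : (l : UDual G) × B l, (W p.1 p.2)ᴴ * W p.1 p.2 = 1) :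
    IsDecomposition σ ρ B W where
  finite := hfin
  intertwines := hint
  norm_block := hnorm
  orth_mult l T S hTS := horth ⟨l, T⟩ ⟨l, S⟩ (sigma_mk_injective.ne hTS)
  orth_irrep l l' T S hl := horth ⟨l, T⟩ ⟨l', S⟩ fun h => hl (congrArg Sigma.fst h)
  complete := hcomplete

variable (h : IsDecomposition σ ρ B W)

include h

theorem finite_mult (l : UDual G) : Finite (B l) :=
  have := h.finite
  Finite.of_injective (Sigma.mk l) sigma_mk_injective

theorem sum_eq_one [Fintype ((l : UDual G) × B l)] :
    ∑ p : (l : UDual G) × B l, (W p.1 p.2)ᴴ * W p.1 p.2 = 1 := by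
  rw [← h.complete, finsum_eq_sum_of_fintype]

theorem eq_of_forall_mul_eq {X Y : Matrix κ κ ℂ} (hXY : ∀ l T, W l T * X = W l T * Y) : X = Y := by
  have := h.finite
  have := Fintype.ofFinite ((l : UDual G) × B l)
  rw [← Matrix.one_mul X, ← Matrix.one_mul Y, ← h.sum_eq_one, Matrix.sum_mul, Matrix.sum_mul]
  refine Finset.sum_congr rfl fun p _ => ?_
  rw [Matrix.mul_assoc, hXY, Matrix.mul_assoc]

theorem apply_eq_sum [Fintype ((l : UDual G) × B l)] (g : G) :
    ρ g = ∑ p : (l : UDual G) × B l, (W p.1 p.2)ᴴ * (σ.mat p.1 g * W p.1 p.2) := by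
  rw [← Matrix.one_mul (ρ g), ← h.sum_eq_one, Matrix.sum_mul]
  refine Finset.sum_congr rfl fun p _ => ?_
  rw [Matrix.mul_assoc, h.intertwines]

theorem mul_conjTranspose_of_ne {p q : (l : UDual G) × B l} (hpq : p ≠ q) :
    W p.1 p.2 * (W q.1 q.2)ᴴ = 0 := by
  obtain ⟨l, T⟩ := p
  obtain ⟨l', S⟩ := q
  by_cases hl : l = l'
  · subst hl
    exact h.orth_mult l T S fun hTS => hpq (congrArg (Sigma.mk l) hTS)
  · exact h.orth_irrep l l' T S hl

theorem mem_intertwiners (l : UDual G) (T : B l) : W l T ∈ intertwiners ρ (σ.mat l) :=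
  h.intertwines l T

theorem conjTranspose_mem_intertwiners (l : UDual G) (T : B l) :
    (W l T)ᴴ ∈ intertwiners (σ.mat l) ρ := fun g => by
  have := h.finite
  have := Fintype.ofFinite ((l : UDual G) × B l)
  symm
  calc ρ g * (W l T)ᴴ
      = ∑ p : (l : UDual G) × B l, (W p.1 p.2)ᴴ * σ.mat p.1 g * (W p.1 p.2 * (W l T)ᴴ) := by
        rw [h.apply_eq_sum g, Matrix.sum_mul]
        simp only [Matrix.mul_assoc]
    _ = (W l T)ᴴ * σ.mat l g := by
        rw [Finset.sum_eq_single ⟨l, T⟩, h.norm_block, Matrix.mul_one]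
        · intro p _ hp
          rw [h.mul_conjTranspose_of_ne (q := ⟨l, T⟩) hp, Matrix.mul_zero]
        · exact fun hlT => absurd (Finset.mem_univ _) hlT

theorem isUnitaryRep : IsUnitaryRep ρ where
  continuous := by
    have := h.finite
    have := Fintype.ofFinite ((l : UDual G) × B l)
    rw [funext h.apply_eq_sum]
    exact continuous_finsetSum _ fun p _ => continuous_const.matrix_mul
      ((σ.isUnitaryRep p.1).continuous.matrix_mul continuous_const)
  map_one := h.eq_of_forall_mul_eq fun l T => by
    rw [h.intertwines, (σ.isUnitaryRep l).map_one, Matrix.one_mul, Matrix.mul_one]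
  map_mul g g' := h.eq_of_forall_mul_eq fun l T => by
    rw [h.intertwines, (σ.isUnitaryRep l).map_mul, Matrix.mul_assoc, ← h.intertwines,
      ← Matrix.mul_assoc, ← h.intertwines, Matrix.mul_assoc]
  map_inv g := h.eq_of_forall_mul_eq fun l T => by
    have hstar := congrArg Matrix.conjTranspose (h.conjTranspose_mem_intertwiners l T g)
    simp only [Matrix.conjTranspose_mul, Matrix.conjTranspose_conjTranspose] at hstar
    rw [h.intertwines, (σ.isUnitaryRep l).map_inv, hstar]

theorem eq_zero_of_forall_mul_conjTranspose_eq_zero {l : UDual G}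
    {A : Matrix (Fin (σ.d l)) κ ℂ} (hA : A ∈ intertwiners ρ (σ.mat l))
    (hAW : ∀ T, A * (W l T)ᴴ = 0) : A = 0 := by
  have := h.finite
  have := Fintype.ofFinite ((l : UDual G) × B l)
  rw [← Matrix.mul_one A, ← h.sum_eq_one, Matrix.mul_sum]
  refine Finset.sum_eq_zero fun ⟨l', T⟩ _ => ?_
  rw [← Matrix.mul_assoc]
  by_cases hl : l = l'
  · subst hl
    rw [hAW, Matrix.zero_mul]
  · rw [σ.eq_zero_of_mem_intertwiners hl
      (mul_mem_intertwiners hA (h.conjTranspose_mem_intertwiners l' T)), Matrix.zero_mul]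

theorem mul_mul_conjTranspose_eq_smul_one {X : Matrix κ κ ℂ} (hX : X ∈ intertwiners ρ ρ)
    (l : UDual G) (T S : B l) :
    W l T * X * (W l S)ᴴ = ((σ.d l : ℂ)⁻¹ * ((matUnit W l T S)ᴴ * X).trace) • 1 := by
  rw [σ.eq_trace_smul_one (mul_mem_intertwiners (mul_mem_intertwiners (h.mem_intertwiners l T) hX)
    (h.conjTranspose_mem_intertwiners l S)), matUnit, Matrix.conjTranspose_mul,
    Matrix.conjTranspose_conjTranspose, Matrix.trace_mul_comm _ (W l S)ᴴ, Matrix.mul_assoc]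

theorem mul_mul_conjTranspose_eq_zero {X : Matrix κ κ ℂ} (hX : X ∈ intertwiners ρ ρ)
    {l l' : UDual G} (hl : l ≠ l') (T : B l) (S : B l') : W l T * X * (W l' S)ᴴ = 0 :=
  σ.eq_zero_of_mem_intertwiners hl (mul_mem_intertwiners
    (mul_mem_intertwiners (h.mem_intertwiners l T) hX) (h.conjTranspose_mem_intertwiners l' S))

theorem eq_sum_smul_matUnit [∀ l, Fintype (B l)] {L : Finset (UDual G)}
    (hL : ∀ l ∉ L, IsEmpty (B l)) {X : Matrix κ κ ℂ} (hX : X ∈ intertwiners ρ ρ) :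
    X = ∑ l ∈ L, ∑ T, ∑ S, ((σ.d l : ℂ)⁻¹ * ((matUnit W l T S)ᴴ * X).trace) • matUnit W l T S := by
  have hone : ∑ l ∈ L, ∑ T, (W l T)ᴴ * W l T = 1 := by
    rw [← finsum_sigma_eq_sum hL fun p => (W p.1 p.2)ᴴ * W p.1 p.2, h.complete]
  calc X = (∑ l ∈ L, ∑ T, (W l T)ᴴ * W l T) * X * ∑ l ∈ L, ∑ S, (W l S)ᴴ * W l S := by
        rw [hone, Matrix.one_mul, Matrix.mul_one]
    _ = ∑ l ∈ L, ∑ T, ∑ l' ∈ L, ∑ S, (W l T)ᴴ * (W l T * X * (W l' S)ᴴ) * W l' S := by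
        simp only [Matrix.sum_mul]
        simp only [Matrix.mul_sum, Matrix.mul_assoc]
    _ = ∑ l ∈ L, ∑ T, ∑ S, (W l T)ᴴ * (W l T * X * (W l S)ᴴ) * W l S := by
        refine Finset.sum_congr rfl fun l hl => Finset.sum_congr rfl fun T _ =>
          Finset.sum_eq_single_of_mem l hl fun l' _ hne => Finset.sum_eq_zero fun S _ => ?_
        rw [h.mul_mul_conjTranspose_eq_zero hX hne.symm, Matrix.mul_zero, Matrix.zero_mul]
    _ = _ := by
        refine Finset.sum_congr rfl fun l _ => Finset.sum_congr rfl fun T _ =>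
          Finset.sum_congr rfl fun S _ => ?_
        rw [h.mul_mul_conjTranspose_eq_smul_one hX, Matrix.mul_smul, Matrix.mul_one,
          Matrix.smul_mul]
        rfl

theorem matUnit_mem_intertwiners (l : UDual G) (T S : B l) : matUnit W l T S ∈ intertwiners ρ ρ :=
  mul_mem_intertwiners (h.conjTranspose_mem_intertwiners l T) (h.mem_intertwiners l S)

theorem matUnit_ne_zero (l : UDual G) (T S : B l) : matUnit W l T S ≠ 0 := fun h₀ => by
  apply σ.ne_zero_of_mul_conjTranspose_eq_one (h.norm_block l S)
  rw [← Matrix.one_mul (W l S), ← h.norm_block l T, Matrix.mul_assoc]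
  exact (congrArg (W l T * ·) h₀).trans (Matrix.mul_zero _)

theorem span_matUnit :
    (Submodule.span ℂ {X | ∃ l T S, X = matUnit W l T S}) = intertwiners ρ ρ := by
  obtain ⟨L, hL⟩ := exists_finset_isEmpty h.finite
  have := fun l => h.finite_mult l
  have := fun l => Fintype.ofFinite (B l)
  refine le_antisymm (Submodule.span_le.2 ?_) fun X hX => ?_
  · rintro _ ⟨l, T, S, rfl⟩
    exact h.matUnit_mem_intertwiners l T S
  · rw [h.eq_sum_smul_matUnit hL hX]
    exact Submodule.sum_mem _ fun l _ => Submodule.sum_mem _ fun T _ => Submodule.sum_mem _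
      fun S _ => Submodule.smul_mem _ _ (Submodule.subset_span ⟨l, T, S, rfl⟩)

theorem isCommutantMatrixUnits : IsCommutantMatrixUnits ρ B (matUnit W) := by
  have hmul : ∀ l l' T S T' S', matUnit W l T S * matUnit W l' T' S'
      = (W l T)ᴴ * (W l S * (W l' T')ᴴ) * W l' S' := fun l l' T S T' S' => by
    simp only [matUnit, Matrix.mul_assoc]
  refine ⟨h.matUnit_ne_zero, fun l T S => ?_, fun l T S U => ?_, fun l T S S' U hS => ?_,
    fun l l' T S T' S' hl => ?_, congrArg SetLike.coe h.span_matUnit⟩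
  · rw [matUnit, Matrix.conjTranspose_mul, Matrix.conjTranspose_conjTranspose, matUnit]
  · rw [hmul, h.norm_block, Matrix.mul_one, matUnit]
  · rw [hmul, h.orth_mult _ _ _ hS, Matrix.mul_zero, Matrix.zero_mul]
  · rw [hmul, h.orth_irrep _ _ _ _ hl, Matrix.mul_zero, Matrix.zero_mul]

end IsDecomposition

end Decompositions

section CompleteReducibility

variable {G : Type*} [Group G] [TopologicalSpace G] {σ : IrrepBasis G} {κ : Type*} [Fintype κ]

/-- The first row of a block. By Schur's lemma it determines an intertwiner, isometrically. -/
def firstRow {l : UDual G} : Matrix (Fin (σ.d l)) κ ℂ →ₗ[ℂ] EuclideanSpace ℂ κ where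
  toFun A := WithLp.toLp 2 (A ⟨0, σ.d_pos l⟩)
  map_add' _ _ := rfl
  map_smul' _ _ := rfl

theorem inner_firstRow {l l' : UDual G} (A : Matrix (Fin (σ.d l)) κ ℂ)
    (A' : Matrix (Fin (σ.d l')) κ ℂ) :
    ⟪firstRow A, firstRow A'⟫_ℂ = (A' * Aᴴ) ⟨0, σ.d_pos l'⟩ ⟨0, σ.d_pos l⟩ := rfl

theorem orthonormal_firstRow {P : Type*} {l : P → UDual G}
    {W : (p : P) → Matrix (Fin (σ.d (l p))) κ ℂ} (hnorm : ∀ p, W p * (W p)ᴴ = 1)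
    (horth : ∀ p q, p ≠ q → W p * (W q)ᴴ = 0) : Orthonormal ℂ fun p => firstRow (W p) := by
  classical
  rw [orthonormal_iff_ite]
  intro p q
  rw [inner_firstRow]
  split_ifs with hpq
  · subst hpq
    rw [hnorm, Matrix.one_apply_eq]
  · rw [horth q p (Ne.symm hpq), Matrix.zero_apply]

namespace IsUnitaryRep

variable [DecidableEq κ] {ρ : G → Matrix κ κ ℂ}

theorem mul_conjTranspose_eq_inner_smul (hρ : IsUnitaryRep ρ) {l : UDual G}
    {A A' : Matrix (Fin (σ.d l)) κ ℂ} (hA : A ∈ intertwiners ρ (σ.mat l))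
    (hA' : A' ∈ intertwiners ρ (σ.mat l)) :
    A' * Aᴴ = ⟪firstRow A, firstRow A'⟫_ℂ • (1 : Matrix (Fin (σ.d l)) (Fin (σ.d l)) ℂ) := by
  have hschur := σ.eq_trace_smul_one
    (mul_mem_intertwiners hA' (hρ.conjTranspose_mem_intertwiners (σ.isUnitaryRep l) hA))
  rw [inner_firstRow, hschur, Matrix.smul_apply, Matrix.one_apply_eq, smul_eq_mul, mul_one]

variable {B : UDual G → Type*} {W : (l : UDual G) → B l → Matrix (Fin (σ.d l)) κ ℂ}

theorem exists_mem_intertwiners_mul_eq_zero (σ : IrrepBasis G) (hρ : IsUnitaryRep ρ)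
    {Q : Matrix κ κ ℂ} (hQ : Q ∈ intertwiners ρ ρ) (hQ₁ : Q ≠ 1) (hQQ : Q * Q = Q) :
    ∃ l, ∃ A ∈ intertwiners ρ (σ.mat l), A ≠ 0 ∧ A * Q = 0 := by
  have hQ' : 1 - Q ∈ intertwiners ρ ρ :=
    Submodule.sub_mem _ (fun g => by rw [Matrix.one_mul, Matrix.mul_one]) hQ
  obtain ⟨l, A, hA, _, ⟨v, rfl⟩, hAv⟩ := hρ.exists_mem_intertwiners_mulVec_ne_zero σ
    (S := LinearMap.range (1 - Q).mulVecLin)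
    (by
      rintro g _ ⟨v, rfl⟩
      refine ⟨ρ g *ᵥ v, ?_⟩
      rw [Matrix.mulVecLin_apply, Matrix.mulVecLin_apply, Matrix.mulVec_mulVec,
        Matrix.mulVec_mulVec, hQ' g])
    (by
      rw [Ne, LinearMap.range_eq_bot, ← Matrix.mulVecLin_zero]
      intro h
      refine hQ₁ (sub_eq_zero.1 (Matrix.toLin'.injective h)).symm)
  refine ⟨l, A * (1 - Q), mul_mem_intertwiners hA hQ', fun h => hAv ?_, ?_⟩
  · rw [Matrix.mulVecLin_apply, Matrix.mulVec_mulVec, h, Matrix.zero_mulVec]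
  · rw [Matrix.mul_assoc, Matrix.sub_mul, Matrix.one_mul, hQQ, sub_self, Matrix.mul_zero]

theorem isDecomposition_of_maximal (hρ : IsUnitaryRep ρ)
    (hint : ∀ l T, W l T ∈ intertwiners ρ (σ.mat l)) (hnorm : ∀ l T, W l T * (W l T)ᴴ = 1)
    (horth : ∀ l T S, T ≠ S → W l T * (W l S)ᴴ = 0)
    (hmax : ∀ l, ∀ A ∈ intertwiners ρ (σ.mat l), (∀ T, A * (W l T)ᴴ = 0) → A = 0) :
    IsDecomposition σ ρ B W := by
  have hint' : ∀ l T, (W l T)ᴴ ∈ intertwiners (σ.mat l) ρ := fun l T =>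
    hρ.conjTranspose_mem_intertwiners (σ.isUnitaryRep l) (hint l T)
  have hne : ∀ p q : (l : UDual G) × B l, p ≠ q → W p.1 p.2 * (W q.1 q.2)ᴴ = 0 := by
    rintro ⟨l, T⟩ ⟨l', S⟩ hpq
    by_cases hl : l = l'
    · subst hl
      exact horth _ _ _ fun h => hpq (congrArg (Sigma.mk l) h)
    · exact σ.eq_zero_of_mem_intertwiners hl (mul_mem_intertwiners (hint l T) (hint' l' S))
  have hfin : Finite ((l : UDual G) × B l) :=
    (orthonormal_firstRow (fun p : (l : UDual G) × B l => hnorm p.1 p.2)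
      hne).linearIndependent.finite_of_isNoetherian
  refine .of_orthogonal hfin hint hnorm hne ?_
  have := Fintype.ofFinite ((l : UDual G) × B l)
  rw [finsum_eq_sum_of_fintype]
  set Q := ∑ p : (l : UDual G) × B l, (W p.1 p.2)ᴴ * W p.1 p.2
  have hQW : ∀ l T, Q * (W l T)ᴴ = (W l T)ᴴ := fun l T => by
    rw [Matrix.sum_mul, Finset.sum_eq_single ⟨l, T⟩]
    · rw [Matrix.mul_assoc, hnorm, Matrix.mul_one]
    · intro p _ hp
      rw [Matrix.mul_assoc, hne p ⟨l, T⟩ hp, Matrix.mul_zero]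
    · exact fun h => absurd (Finset.mem_univ _) h
  by_contra hQ₁
  obtain ⟨l, A, hA, hA₀, hAQ⟩ := hρ.exists_mem_intertwiners_mul_eq_zero σ
    (Submodule.sum_mem _ fun p _ => mul_mem_intertwiners (hint' p.1 p.2) (hint p.1 p.2)) hQ₁
    (by simp only [Q, Matrix.mul_sum, ← Matrix.mul_assoc, hQW])
  refine hA₀ (hmax l A hA fun T => ?_)
  rw [← hQW, ← Matrix.mul_assoc, hAQ, Matrix.zero_mul]

open scoped ComplexOrder in
theorem exists_isDecomposition (σ : IrrepBasis G) (hρ : IsUnitaryRep ρ) :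
    ∃ (m : UDual G → ℕ) (W : (l : UDual G) → Fin (m l) → Matrix (Fin (σ.d l)) κ ℂ),
      IsDecomposition σ ρ (fun l => Fin (m l)) W := by
  let b := fun l => stdOrthonormalBasis ℂ ((intertwiners ρ (σ.mat l)).map firstRow)
  choose W hW hWb using fun l T => (b l T).2
  have hinner : ∀ l T S, W l S * (W l T)ᴴ = ⟪b l T, b l S⟫_ℂ • 1 := fun l T S => by
    rw [hρ.mul_conjTranspose_eq_inner_smul (hW l T) (hW l S), hWb, hWb, Submodule.coe_inner]
  refine ⟨_, W, hρ.isDecomposition_of_maximal hW (fun l T => ?_) (fun l T S hTS => ?_)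
    fun l A hA hAW => ?_⟩
  · rw [hinner, orthonormal_iff_ite.1 (b l).orthonormal, if_pos rfl, one_smul]
  · rw [hinner, orthonormal_iff_ite.1 (b l).orthonormal, if_neg hTS.symm, zero_smul]
  · have hA₀ : (⟨firstRow A, A, hA, rfl⟩ : (intertwiners ρ (σ.mat l)).map firstRow) = 0 := by
      refine InnerProductSpace.ext_inner_left_basis (b l).toBasis fun T => ?_
      rw [inner_zero_right, OrthonormalBasis.coe_toBasis, Submodule.coe_inner, ← hWb,
        inner_firstRow, hAW, Matrix.zero_apply]
    have hrow : firstRow A = 0 := congrArg Subtype.val hA₀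
    rw [← Matrix.self_mul_conjTranspose_eq_zero, hρ.mul_conjTranspose_eq_inner_smul hA hA, hrow,
      inner_zero_right, zero_smul]

end IsUnitaryRep

end CompleteReducibility

section HaarAverage

variable {G : Type*} [Group G] [TopologicalSpace G] [MeasurableSpace G] {κ : Type*} [Fintype κ]

open scoped Matrix.Norms.Elementwise in
/-- The average of `ρ(g) X ρ(g)†` over `G`. For Haar measure it is the projection onto the
commutant of `ρ` that is orthogonal for the Frobenius inner product. -/
def twirl (μ : Measure G) (ρ : G → Matrix κ κ ℂ) (X : Matrix κ κ ℂ) : Matrix κ κ ℂ :=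
  ∫ g, ρ g * X * (ρ g)ᴴ ∂μ

namespace IsUnitaryRep

variable [OpensMeasurableSpace G] [CompactSpace G] [DecidableEq κ] {μ : Measure G}
  [IsFiniteMeasureOnCompacts μ] {ρ : G → Matrix κ κ ℂ} (hρ : IsUnitaryRep ρ) (X : Matrix κ κ ℂ)

include hρ

open scoped Matrix.Norms.Elementwise in
theorem map_twirl {E : Type*} [NormedAddCommGroup E] [NormedSpace ℂ E] [CompleteSpace E]
    (L : Matrix κ κ ℂ →ₗ[ℂ] E) : L (twirl μ ρ X) = ∫ g, L (ρ g * X * (ρ g)ᴴ) ∂μ := by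
  have hcont : Continuous fun g => ρ g * X * (ρ g)ᴴ :=
    (hρ.continuous.matrix_mul continuous_const).matrix_mul hρ.continuous.matrix_conjTranspose
  exact (L.toContinuousLinearMap.integral_comp_comm
    (hcont.integrable_of_hasCompactSupport (HasCompactSupport.of_compactSpace _))).symm

theorem twirl_apply (a b : κ) : twirl μ ρ X a b = ∫ g, (ρ g * X * (ρ g)ᴴ) a b ∂μ :=
  hρ.map_twirl X (Matrix.entryLinearMap ℂ ℂ a b)

open scoped Matrix.Norms.Elementwise in
theorem twirl_mem_intertwiners [MeasurableMul G] [μ.IsMulLeftInvariant] :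
    twirl μ ρ X ∈ intertwiners ρ ρ := fun h => by
  have hinv : ρ h * twirl μ ρ X * (ρ h)ᴴ = twirl μ ρ X := by
    refine (hρ.map_twirl X (LinearMap.mulLeftRight ℂ (ρ h, (ρ h)ᴴ))).trans <|
      Eq.trans ?_ (integral_mul_left_eq_self (fun g => ρ g * X * (ρ g)ᴴ) h)
    simp only [LinearMap.mulLeftRight_apply, hρ.map_mul, Matrix.conjTranspose_mul,
      Matrix.mul_assoc]
  conv_lhs => rw [← hinv]
  rw [Matrix.mul_assoc, hρ.conjTranspose_mul, Matrix.mul_one]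

theorem trace_mul_twirl [IsProbabilityMeasure μ] {A : Matrix κ κ ℂ} (hA : A ∈ intertwiners ρ ρ) :
    (A * twirl μ ρ X).trace = (A * X).trace := by
  have hconst : ∀ g, (A * (ρ g * X * (ρ g)ᴴ)).trace = (A * X).trace := fun g => by
    rw [Matrix.mul_assoc (ρ g), ← Matrix.mul_assoc, hA g, Matrix.mul_assoc, Matrix.trace_mul_comm,
      Matrix.mul_assoc, Matrix.mul_assoc, hρ.conjTranspose_mul, Matrix.mul_one]
  refine (hρ.map_twirl X (Matrix.traceLinearMap κ ℂ ℂ ∘ₗ LinearMap.mulLeft ℂ A)).trans ?_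
  simp only [LinearMap.comp_apply, LinearMap.mulLeft_apply, Matrix.traceLinearMap_apply, hconst,
    integral_const, probReal_univ, one_smul]

end IsUnitaryRep

variable [OpensMeasurableSpace G] [CompactSpace G] [MeasurableMul G] [DecidableEq κ]
  {μ : Measure G} [μ.IsMulLeftInvariant] [IsProbabilityMeasure μ] {ρ : G → Matrix κ κ ℂ}
  {σ : IrrepBasis G} {B : UDual G → Type*} {W : (l : UDual G) → B l → Matrix (Fin (σ.d l)) κ ℂ}

theorem IsDecomposition.integral_eq (h : IsDecomposition σ ρ B W) (a b a' b' : κ) :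
    ∫ g, ρ g b a * conj (ρ g b' a') ∂μ = ∑ᶠ l : UDual G, (σ.d l : ℂ)⁻¹ *
      ∑ᶠ T : B l, ∑ᶠ S : B l, matUnit W l T S a' a * conj (matUnit W l T S b' b) := by
  have hρ := h.isUnitaryRep
  obtain ⟨L, hL⟩ := exists_finset_isEmpty h.finite
  have := fun l => h.finite_mult l
  have := fun l => Fintype.ofFinite (B l)
  have hstar : ∀ l T S, (matUnit W l T S)ᴴ = matUnit W l S T := h.isCommutantMatrixUnits.star
  have htwirl := h.eq_sum_smul_matUnit hL
    (hρ.twirl_mem_intertwiners (μ := μ) (Matrix.single a a' 1))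
  simp only [hρ.trace_mul_twirl _ (hstar _ _ _ ▸ h.matUnit_mem_intertwiners _ _ _)] at htwirl
  simp only [finsum_eq_sum_of_fintype]
  rw [finsum_eq_sum_of_forall_notMem (L := L) fun l hl => by
    have := hL l hl
    rw [Finset.univ_eq_empty, Finset.sum_empty, mul_zero]]
  calc ∫ g, ρ g b a * conj (ρ g b' a') ∂μ = twirl μ ρ (Matrix.single a a' 1) b b' := by
        rw [hρ.twirl_apply]
        simp [Matrix.mul_apply, Matrix.single_apply, ite_and]
    _ = ∑ l ∈ L, ∑ T, ∑ S, (σ.d l : ℂ)⁻¹ * matUnit W l S T a' a * matUnit W l T S b b' := by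
        rw [htwirl]
        simp [Matrix.sum_apply, hstar, Matrix.trace_mul_single]
    _ = _ := by
        refine Finset.sum_congr rfl fun l _ => ?_
        rw [Finset.sum_comm, Finset.mul_sum]
        refine Finset.sum_congr rfl fun T _ => ?_
        rw [Finset.mul_sum]
        refine Finset.sum_congr rfl fun S _ => ?_
        rw [mul_assoc, ← hstar l T S, Matrix.conjTranspose_apply]
        rfl

end HaarAverage

section ClebschGordan

variable {α β ι : Type*}

/-- The adjoint of a tensor `V_β ⊗ V → V_α` with the wire `V` bent, a tensor `V_α ⊗ V̄ → V_β`. -/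
def bend (A : Matrix α (β × ι) ℂ) : Matrix β (α × ι) ℂ :=
  Matrix.of fun N p => conj (A p.1 (N, p.2))

theorem bend_bend (A : Matrix α (β × ι) ℂ) : bend (bend A) = A := by
  ext M ⟨N, x⟩
  simp [bend]

theorem bend_zero : bend (0 : Matrix α (β × ι) ℂ) = 0 := by
  ext M N
  simp [bend]

theorem trace_bend_mul [Fintype α] [Fintype β] [Fintype ι] (A B : Matrix α (β × ι) ℂ) :
    (bend A * (bend B)ᴴ).trace = (B * Aᴴ).trace := by
  simp only [Matrix.trace, Matrix.diag_apply, Matrix.mul_apply, bend, Matrix.of_apply,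
    Matrix.conjTranspose_apply, RCLike.star_def, Complex.conj_conj, Fintype.sum_prod_type]
  rw [Finset.sum_comm]
  exact Finset.sum_congr rfl fun M _ => Finset.sum_congr rfl fun N _ =>
    Finset.sum_congr rfl fun x _ => mul_comm _ _

theorem bend_mul [Fintype α] [Fintype ι] [DecidableEq ι] (Y : Matrix α α ℂ)
    (A : Matrix α (β × ι) ℂ) : bend (Y * A) = bend A * (Yᴴ ⊗ₖ (1 : Matrix ι ι ℂ)) := by
  ext N ⟨M, x⟩
  simp [bend, Matrix.mul_apply, Fintype.sum_prod_type, Matrix.one_apply, mul_comm]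

theorem bend_mul_kronecker [Fintype α] [DecidableEq α] [Fintype β] [Fintype ι]
    (A : Matrix α (β × ι) ℂ) (X : Matrix β β ℂ) (Z : Matrix ι ι ℂ) :
    bend (A * (X ⊗ₖ Z)) = Xᴴ * bend A * ((1 : Matrix α α ℂ) ⊗ₖ Z.map star) := by
  ext N ⟨M, x⟩
  simp only [bend, Matrix.mul_apply, Fintype.sum_prod_type, Matrix.of_apply,
    Matrix.kroneckerMap_apply, map_sum, map_mul, Matrix.one_apply, Matrix.map_apply,
    Matrix.conjTranspose_apply, RCLike.star_def, ite_mul, one_mul, zero_mul, mul_ite, mul_zero,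
    Finset.sum_mul]
  rw [Finset.sum_comm' (t' := Finset.univ) (s' := fun _ => Finset.univ) (by simp)]
  simp [mul_comm, mul_left_comm]

variable {G : Type*} [Group G] [TopologicalSpace G] {σ : IrrepBasis G}
  {m : UDual G → UDual G → ℕ}

/-- The factor relating a Clebsch–Gordan tensor `V_{l'} ⊗ V → V_l` to its dual; bending turns the
trace `d_l` of its Gram matrix into `d_{l'}`. -/
def dualScale (σ : IrrepBasis G) (l l' : UDual G) : ℝ := √(σ.d l' / σ.d l)

theorem dualScale_pos (σ : IrrepBasis G) (l l' : UDual G) : 0 < dualScale σ l l' :=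
  Real.sqrt_pos.2 (div_pos (Nat.cast_pos.2 (σ.d_pos _)) (Nat.cast_pos.2 (σ.d_pos _)))

theorem dualScale_mul_self (σ : IrrepBasis G) (l l' : UDual G) :
    (dualScale σ l l' * dualScale σ l l' : ℂ) = σ.d l' / σ.d l := by
  rw [dualScale, ← Complex.ofReal_mul, Real.mul_self_sqrt (by positivity), Complex.ofReal_div,
    Complex.ofReal_natCast, Complex.ofReal_natCast]

theorem dualScale_mul_dualScale (σ : IrrepBasis G) (l l' : UDual G) :
    (dualScale σ l l' * dualScale σ l' l : ℂ) = 1 := by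
  have hpos (l : UDual G) : (0 : ℝ) < σ.d l := Nat.cast_pos.2 (σ.d_pos l)
  rw [← Complex.ofReal_mul, dualScale, dualScale,
    ← Real.sqrt_mul (div_nonneg (hpos l').le (hpos l).le),
    div_mul_div_cancel₀ (hpos l).ne', div_self (hpos l').ne', Real.sqrt_one, Complex.ofReal_one]

/-- The dual Clebsch–Gordan tensors: the bent tensors of `C`, rescaled to be coisometries. -/
def dualTensor (C : CGTensor σ ι m) : CGTensor σ ι fun l l' => m l' l :=
  fun l l' i => (dualScale σ l l' : ℂ) • bend (C l' l i)

theorem dualTensor_dualTensor (C : CGTensor σ ι m) : dualTensor (dualTensor C) = C := by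
  funext l l' i
  ext M p
  simp [dualTensor, bend, ← mul_assoc, dualScale_mul_dualScale]

variable [Fintype ι]

theorem trace_dualTensor_mul_conjTranspose (C : CGTensor σ ι m) (l l' : UDual G)
    (i j : Fin (m l' l)) : (dualTensor C l l' i * (dualTensor C l l' j)ᴴ).trace
      = σ.d l' / σ.d l * (C l' l j * (C l' l i)ᴴ).trace := by
  rw [dualTensor, dualTensor, Matrix.conjTranspose_smul, Matrix.smul_mul, Matrix.mul_smul,
    smul_smul, Matrix.trace_smul, trace_bend_mul, RCLike.star_def, Complex.conj_ofReal,
    smul_eq_mul, dualScale_mul_self]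

theorem bend_mem_intertwiners [Fintype α] [DecidableEq α] [Fintype β] [DecidableEq β]
    {ρ : G → Matrix β β ℂ} {τ : G → Matrix α α ℂ} (hρ : IsUnitaryRep ρ) (hτ : IsUnitaryRep τ)
    {υ : G → Matrix ι ι ℂ} {A : Matrix α (β × ι) ℂ}
    (hA : A ∈ intertwiners (fun g => ρ g ⊗ₖ υ g) τ) :
    bend A ∈ intertwiners (fun g => τ g ⊗ₖ (υ g).map star) ρ := fun g => by
  classical
  have hbend : (ρ g)ᴴ * bend A * ((1 : Matrix α α ℂ) ⊗ₖ (υ g).map star)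
      = bend A * ((τ g)ᴴ ⊗ₖ (1 : Matrix ι ι ℂ)) := by
    rw [← bend_mul_kronecker, hA g, bend_mul]
  calc bend A * (τ g ⊗ₖ (υ g).map star)
      = ρ g * ((ρ g)ᴴ * bend A * ((1 : Matrix α α ℂ) ⊗ₖ (υ g).map star)) *
          (τ g ⊗ₖ (1 : Matrix ι ι ℂ)) := by
        rw [← Matrix.mul_assoc, ← Matrix.mul_assoc, hρ.mul_conjTranspose, Matrix.one_mul,
          Matrix.mul_assoc, ← Matrix.mul_kronecker_mul, Matrix.one_mul, Matrix.mul_one]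
    _ = ρ g * bend A := by
        rw [hbend, Matrix.mul_assoc, Matrix.mul_assoc, ← Matrix.mul_kronecker_mul,
          hτ.conjTranspose_mul, Matrix.one_mul, Matrix.one_kronecker_one, Matrix.mul_one]

variable [DecidableEq ι]

theorem IsUnitaryRep.exists_isCG {ρ : G → Matrix ι ι ℂ} (hρ : IsUnitaryRep ρ)
    (σ : IrrepBasis G) :
    ∃ (m : UDual G → UDual G → ℕ) (C : CGTensor σ ι m), IsCG σ ρ m C := by
  choose m C hC using fun l => ((σ.isUnitaryRep l).kronecker hρ).exists_isDecomposition σ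
  exact ⟨m, C, hC⟩

theorem dualTensor_mem_intertwiners {ρ : G → Matrix ι ι ℂ} {C : CGTensor σ ι m}
    (hC : IsCG σ ρ m C) (l l' : UDual G) (i : Fin (m l' l)) : dualTensor C l l' i ∈
      intertwiners (fun g => σ.mat l g ⊗ₖ (ρ g).map star) (σ.mat l') :=
  Submodule.smul_mem _ _ <| bend_mem_intertwiners (σ.isUnitaryRep l') (σ.isUnitaryRep l)
    ((hC l').mem_intertwiners l i)

theorem IsUnitaryRep.isCG_dualTensor {ρ : G → Matrix ι ι ℂ} (hρ : IsUnitaryRep ρ)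
    {C : CGTensor σ ι m} (hC : IsCG σ ρ m C) :
    IsCG σ (fun g => (ρ g).map star) (fun l l' => m l' l) (dualTensor C) := fun l => by
  have hτ := (σ.isUnitaryRep l).kronecker hρ.map_star
  have hint := dualTensor_mem_intertwiners hC l
  have hscalar : ∀ l' (i j : Fin (m l' l)), dualTensor C l l' i * (dualTensor C l l' j)ᴴ
      = ((σ.d l : ℂ)⁻¹ * (C l' l j * (C l' l i)ᴴ).trace) • 1 := fun l' i j => by
    rw [σ.eq_trace_smul_one (mul_mem_intertwiners (hint l' i)
      (hτ.conjTranspose_mem_intertwiners (σ.isUnitaryRep l') (hint l' j))),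
      trace_dualTensor_mul_conjTranspose, div_eq_mul_inv, mul_assoc,
      inv_mul_cancel_left₀ (σ.d_ne_zero l')]
  refine hτ.isDecomposition_of_maximal hint (fun l' i => ?_) (fun l' i j hij => ?_)
    fun l' A hA hAD => ?_
  · rw [hscalar, (hC l').norm_block, Matrix.trace_one, Fintype.card_fin,
      inv_mul_cancel₀ (σ.d_ne_zero l), one_smul]
  · rw [hscalar, (hC l').orth_mult _ _ _ hij.symm, Matrix.trace_zero, mul_zero, zero_smul]
  · have hA' := bend_mem_intertwiners (σ.isUnitaryRep l) (σ.isUnitaryRep l') hA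
    simp only [Matrix.map_map, star_involutive.comp_self, Matrix.map_id] at hA'
    rw [← bend_bend A, (hC l').eq_zero_of_forall_mul_conjTranspose_eq_zero hA' fun i => ?_,
      bend_zero]
    have hbend : bend (C l' l i) * Aᴴ = 0 := by
      have h := congrArg Matrix.conjTranspose (hAD i)
      rw [dualTensor, Matrix.conjTranspose_mul, Matrix.conjTranspose_conjTranspose,
        Matrix.smul_mul, Matrix.conjTranspose_zero, smul_eq_zero] at h
      exact h.resolve_left (Complex.ofReal_ne_zero.2 (dualScale_pos σ l l').ne')
    rw [σ.eq_trace_smul_one (mul_mem_intertwiners hA' ((hC l').conjTranspose_mem_intertwiners l i)),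
      ← bend_bend (C l' l i), trace_bend_mul, hbend, Matrix.trace_zero, mul_zero, zero_smul]

theorem isDualCG_dualTensor {R : G →* Matrix.unitaryGroup ι ℂ}
    (hR : Continuous fun g => (R g : Matrix ι ι ℂ)) {C : CGTensor σ ι m}
    (hC : IsCG σ (fun g => (R g : Matrix ι ι ℂ)) m C) : IsDualCG σ R C (dualTensor C) where
  isCG := (IsUnitaryRep.of_hom hR).isCG_dualTensor hC
  matched l l' _ := ⟨dualScale σ l l', dualScale_pos σ l l', fun _ _ _ => rfl⟩

theorem IsDualCG.eq_dualTensor {R : G →* Matrix.unitaryGroup ι ℂ} {C : CGTensor σ ι m}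
    (hC : IsCG σ (fun g => (R g : Matrix ι ι ℂ)) m C) {D : CGTensor σ ι fun l l' => m l' l}
    (hD : IsDualCG σ R C D) : D = dualTensor C := by
  funext l l' i
  obtain ⟨c, hc, hmatched⟩ := hD.matched l l' i
  have hDc : D l l' i = (c : ℂ) • bend (C l' l i) := by
    ext M' ⟨M, x⟩
    exact hmatched M' M x
  have htrace := congrArg Matrix.trace ((hD.isCG l).norm_block l' i)
  rw [hDc, Matrix.conjTranspose_smul, Matrix.smul_mul, Matrix.mul_smul, smul_smul,
    Matrix.trace_smul, trace_bend_mul, (hC l').norm_block, Matrix.trace_one, Matrix.trace_one,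
    Fintype.card_fin, Fintype.card_fin, RCLike.star_def, Complex.conj_ofReal, smul_eq_mul,
    ← eq_div_iff (σ.d_ne_zero l), ← dualScale_mul_self] at htrace
  have hsq : c * c = dualScale σ l l' * dualScale σ l l' := by exact_mod_cast htrace
  rw [hDc, (mul_self_inj hc.le (dualScale_pos σ l l').le).1 hsq, dualTensor]

end ClebschGordan

section Paths

variable {G : Type*} [Group G] [TopologicalSpace G] {σ : IrrepBasis G}

theorem IsDecomposition.reindex {κ κ' : Type*} [Fintype κ] [DecidableEq κ] [Fintype κ']
    [DecidableEq κ'] {ρ : G → Matrix κ κ ℂ} {B : UDual G → Type*}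
    {W : (l : UDual G) → B l → Matrix (Fin (σ.d l)) κ ℂ} (h : IsDecomposition σ ρ B W)
    (e : κ' ≃ κ) :
    IsDecomposition σ (fun g => (ρ g).submatrix e e) B fun l T => (W l T).submatrix id e := by
  have hmul : ∀ l l' T S,
      (W l T).submatrix id e * ((W l' S).submatrix id e)ᴴ = W l T * (W l' S)ᴴ := fun l l' T S => by
    rw [Matrix.conjTranspose_submatrix, Matrix.submatrix_mul_equiv, Matrix.submatrix_id_id]
  refine .of_orthogonal h.finite (fun l T g => ?_) (fun l T => ?_) (fun p q hpq => ?_) ?_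
  · rw [Matrix.submatrix_mul_equiv, h.intertwines]
    rfl
  · rw [hmul, h.norm_block]
  · rw [hmul, h.mul_conjTranspose_of_ne hpq]
  · have := h.finite
    have := Fintype.ofFinite ((l : UDual G) × B l)
    rw [finsum_eq_sum_of_fintype, ← Matrix.submatrix_one_equiv e, ← h.sum_eq_one]
    ext i j
    simp [Matrix.sum_apply, Matrix.mul_apply]

section Composition

variable {κ ι : Type*} [Fintype ι] [DecidableEq ι] {τ : G → Matrix ι ι ℂ}
  {B' : UDual G → UDual G → Type*}
  {C : (l l' : UDual G) → B' l l' → Matrix (Fin (σ.d l')) (Fin (σ.d l) × ι) ℂ}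

theorem IsDecomposition.sum_conjTranspose_mul_comp
    [∀ l, Fintype ((l' : UDual G) × B' l l')]
    (hC : ∀ l, IsDecomposition σ (fun g => σ.mat l g ⊗ₖ τ g) (B' l) (C l)) (l : UDual G)
    (A : Matrix (Fin (σ.d l)) κ ℂ) :
    ∑ r : (l' : UDual G) × B' l l', (C l r.1 r.2 * (A ⊗ₖ (1 : Matrix ι ι ℂ)))ᴴ *
      (C l r.1 r.2 * (A ⊗ₖ (1 : Matrix ι ι ℂ))) = (Aᴴ * A) ⊗ₖ (1 : Matrix ι ι ℂ) := by
  calc _ = (Aᴴ ⊗ₖ (1 : Matrix ι ι ℂ)) *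
        (∑ r : (l' : UDual G) × B' l l', (C l r.1 r.2)ᴴ * C l r.1 r.2) *
          (A ⊗ₖ (1 : Matrix ι ι ℂ)) := by
        simp only [Matrix.mul_sum, Matrix.sum_mul, Matrix.conjTranspose_mul,
          Matrix.conjTranspose_kronecker, Matrix.conjTranspose_one, Matrix.mul_assoc]
    _ = _ := by
        rw [(hC l).sum_eq_one, Matrix.mul_one, ← Matrix.mul_kronecker_mul, Matrix.mul_one]

variable [Fintype κ]

theorem mul_kronecker_one_mul_conjTranspose {α β α' β' : Type*} [Fintype β] [Fintype β']
    (A : Matrix α (β × ι) ℂ) (W : Matrix β κ ℂ) (A' : Matrix α' (β' × ι) ℂ) (W' : Matrix β' κ ℂ) :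
    A * (W ⊗ₖ (1 : Matrix ι ι ℂ)) * (A' * (W' ⊗ₖ (1 : Matrix ι ι ℂ)))ᴴ
      = A * ((W * W'ᴴ) ⊗ₖ (1 : Matrix ι ι ℂ)) * A'ᴴ := by
  have hmul : (W * W'ᴴ) ⊗ₖ (1 : Matrix ι ι ℂ)
      = (W ⊗ₖ (1 : Matrix ι ι ℂ)) * (W'ᴴ ⊗ₖ (1 : Matrix ι ι ℂ)) := by
    rw [← Matrix.mul_kronecker_mul, Matrix.mul_one]
  rw [hmul, Matrix.conjTranspose_mul, Matrix.conjTranspose_kronecker, Matrix.conjTranspose_one]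
  simp only [Matrix.mul_assoc]

variable [DecidableEq κ] {ρ : G → Matrix κ κ ℂ} {B : UDual G → Type*}
  {W : (l : UDual G) → B l → Matrix (Fin (σ.d l)) κ ℂ}

theorem IsDecomposition.comp_mul_conjTranspose_of_ne (h : IsDecomposition σ ρ B W)
    (hC : ∀ l, IsDecomposition σ (fun g => σ.mat l g ⊗ₖ τ g) (B' l) (C l)) {l l' : UDual G}
    {T : (k : UDual G) × (B k × B' k l)} {S : (k : UDual G) × (B k × B' k l')}
    (hne : (⟨l, T⟩ : (l : UDual G) × (k : UDual G) × (B k × B' k l)) ≠ ⟨l', S⟩) :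
    C T.1 l T.2.2 * (W T.1 T.2.1 ⊗ₖ (1 : Matrix ι ι ℂ)) *
      (C S.1 l' S.2.2 * (W S.1 S.2.1 ⊗ₖ (1 : Matrix ι ι ℂ)))ᴴ = 0 := by
  obtain ⟨k, T, i⟩ := T
  obtain ⟨k', S, j⟩ := S
  rw [mul_kronecker_one_mul_conjTranspose]
  by_cases hTS : (⟨k, T⟩ : (k : UDual G) × B k) = ⟨k', S⟩
  · obtain ⟨rfl, hTS⟩ := Sigma.mk.inj hTS
    obtain rfl := eq_of_heq hTS
    rw [h.norm_block, Matrix.one_kronecker_one, Matrix.mul_one]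
    refine (hC k).mul_conjTranspose_of_ne (p := ⟨l, i⟩) (q := ⟨l', j⟩) fun hij => hne ?_
    obtain ⟨rfl, hij⟩ := Sigma.mk.inj hij
    obtain rfl := eq_of_heq hij
    rfl
  · rw [h.mul_conjTranspose_of_ne hTS, Matrix.zero_kronecker, Matrix.mul_zero, Matrix.zero_mul]

theorem IsDecomposition.comp (h : IsDecomposition σ ρ B W)
    (hC : ∀ l, IsDecomposition σ (fun g => σ.mat l g ⊗ₖ τ g) (B' l) (C l)) :
    IsDecomposition σ (fun g => ρ g ⊗ₖ τ g) (fun l' => (l : UDual G) × (B l × B' l l'))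
      fun l' T => C T.1 l' T.2.2 * (W T.1 T.2.1 ⊗ₖ (1 : Matrix ι ι ℂ)) := by
  let e : ((p : (l : UDual G) × B l) × ((l' : UDual G) × B' p.1 l')) ≃
      ((l' : UDual G) × ((l : UDual G) × (B l × B' l l'))) :=
    { toFun := fun p => ⟨p.2.1, p.1.1, p.1.2, p.2.2⟩
      invFun := fun p => ⟨⟨p.2.1, p.2.2.1⟩, p.1, p.2.2.2⟩
      left_inv := fun _ => rfl
      right_inv := fun _ => rfl }
  have := h.finite
  have : ∀ l, Finite ((l' : UDual G) × B' l l') := fun l => (hC l).finite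
  refine .of_orthogonal (Finite.of_equiv _ e) ?_ ?_ ?_ ?_
  · rintro l' ⟨l, T, i⟩ g
    calc C l l' i * (W l T ⊗ₖ (1 : Matrix ι ι ℂ)) * (ρ g ⊗ₖ τ g)
        = C l l' i * (σ.mat l g ⊗ₖ τ g) * (W l T ⊗ₖ (1 : Matrix ι ι ℂ)) := by
          rw [Matrix.mul_assoc, Matrix.mul_assoc, ← Matrix.mul_kronecker_mul,
            ← Matrix.mul_kronecker_mul, h.intertwines, Matrix.one_mul, Matrix.mul_one]
      _ = σ.mat l' g * (C l l' i * (W l T ⊗ₖ (1 : Matrix ι ι ℂ))) := by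
          rw [(hC l).intertwines, Matrix.mul_assoc]
  · rintro l' ⟨l, T, i⟩
    rw [mul_kronecker_one_mul_conjTranspose, h.norm_block, Matrix.one_kronecker_one,
      Matrix.mul_one, (hC l).norm_block]
  · rintro ⟨l, T⟩ ⟨l', S⟩ hne
    exact h.comp_mul_conjTranspose_of_ne hC hne
  · have := Fintype.ofFinite ((l : UDual G) × B l)
    have (l : UDual G) : Fintype ((l' : UDual G) × B' l l') := Fintype.ofFinite _
    rw [← finsum_comp_equiv e, finsum_eq_sum_of_fintype, Fintype.sum_sigma]
    refine (Finset.sum_congr rfl fun p _ =>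
      IsDecomposition.sum_conjTranspose_mul_comp hC p.1 (W p.1 p.2)).trans ?_
    rw [← Matrix.one_kronecker_one, ← h.sum_eq_one]
    ext i j
    simp only [Matrix.sum_apply, Matrix.kroneckerMap_apply, Finset.sum_mul]

end Composition

theorem IrrepBasis.d_triv_and_mat_triv (σ : IrrepBasis G) :
    σ.d (triv G) = 1 ∧ ∀ g, σ.mat (triv G) g = 1 := by
  obtain ⟨U, hUU, hUU', hU⟩ : ∃ U : Matrix (Fin (σ.d (triv G))) (Fin 1) ℂ,
      Uᴴ * U = 1 ∧ U * Uᴴ = 1 ∧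
        ∀ g : G, U * ((1 : G →* Matrix.unitaryGroup (Fin 1) ℂ) g : Matrix (Fin 1) (Fin 1) ℂ)
          = σ.mat (triv G) g * U :=
    Quotient.exact (σ.mk_irrep (triv G))
  constructor
  · have htrace := Matrix.trace_mul_comm U Uᴴ
    rw [hUU, hUU', Matrix.trace_one, Matrix.trace_one, Fintype.card_fin, Fintype.card_fin]
      at htrace
    exact_mod_cast htrace
  · intro g
    rw [← Matrix.mul_one (σ.mat _ g), ← hUU', ← Matrix.mul_assoc, ← hU, MonoidHom.one_apply,
      OneMemClass.coe_one, Matrix.mul_one]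

instance IrrepBasis.subsingleton_fin_d_triv (σ : IrrepBasis G) :
    Subsingleton (Fin (σ.d (triv G))) := by
  rw [σ.d_triv_and_mat_triv.1]
  infer_instance

variable {ι : Type*} [Fintype ι] [DecidableEq ι] {R : G →* Matrix.unitaryGroup ι ℂ}
  {m : UDual G → UDual G → ℕ} {C : CGTensor σ ι m} {D : CGTensor σ ι fun l l' => m l' l}

theorem isCG_stepTensor (hC : IsCG σ (fun g => (R g : Matrix ι ι ℂ)) m C)
    (hD : IsCG σ (conjRep R) (fun l l' => m l' l) D) (q : Query) :
    IsCG σ (q.base R) (stepMult m q) (stepTensor C D q) := by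
  cases q
  exacts [hC, hD, hC, hD]

instance subsingleton_sigma_irrepPath_zero (q : Fin 0 → Query) :
    Subsingleton ((l : UDual G) × IrrepPath m 0 q l) where
  allEq := by
    rintro ⟨_, ⟨⟨rfl⟩⟩⟩ ⟨_, ⟨⟨rfl⟩⟩⟩
    rfl

theorem isDecomposition_pathTensor_zero (q : Fin 0 → Query) :
    IsDecomposition σ (tensorRep R q) (IrrepPath m 0 q) (pathTensor C D 0 q) := by
  refine .of_orthogonal Finite.of_subsingleton ?_ ?_
    (fun p p' hne => absurd (Subsingleton.elim p p') hne) ?_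
  · rintro _ ⟨⟨rfl⟩⟩ g
    have hone : tensorRep R q g = 1 := by
      ext a b
      rw [Subsingleton.elim a b, Matrix.one_apply_eq]
      simp [tensorRep]
    rw [hone, σ.d_triv_and_mat_triv.2, Matrix.mul_one, Matrix.one_mul]
  · rintro _ ⟨⟨rfl⟩⟩
    ext M N
    rw [Subsingleton.elim M N, Matrix.mul_apply, Matrix.one_apply_eq]
    simp [pathTensor]
  · have := uniqueOfSubsingleton (⟨triv G, ⟨⟨rfl⟩⟩⟩ : (l : UDual G) × IrrepPath m 0 q l)
    rw [finsum_unique]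
    ext a b
    rw [Subsingleton.elim a b, Matrix.one_apply_eq]
    simp [Matrix.mul_apply, pathTensor, Subsingleton.elim default
      (⟨triv G, ⟨⟨rfl⟩⟩⟩ : (l : UDual G) × IrrepPath m 0 q l), σ.d_triv_and_mat_triv.1]

theorem isDecomposition_pathTensor_succ {n : ℕ} {q : Fin (n + 1) → Query}
    (hC : IsCG σ (q (Fin.last n) |>.base R) _ (stepTensor C D (q (Fin.last n))))
    (h : IsDecomposition σ (tensorRep R (Fin.init q)) (IrrepPath m n (Fin.init q))
      (pathTensor C D n (Fin.init q))) :
    IsDecomposition σ (tensorRep R q) (IrrepPath m (n + 1) q) (pathTensor C D (n + 1) q) := by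
  let e : (Fin (n + 1) → ι) ≃ (Fin n → ι) × ι :=
    (Fin.snocEquiv fun _ => ι).symm.trans (Equiv.prodComm _ _)
  have hrep : tensorRep R q = fun g =>
      (tensorRep R (Fin.init q) g ⊗ₖ (q (Fin.last n)).base R g).submatrix e e := by
    funext g
    ext a b
    simp [tensorRep, e, Fin.prod_univ_castSucc, Fin.init]
  have htensor : pathTensor C D (n + 1) q = fun l' T =>
      (stepTensor C D (q (Fin.last n)) T.1 l' T.2.2 *
        (pathTensor C D n (Fin.init q) T.1 T.2.1 ⊗ₖ (1 : Matrix ι ι ℂ))).submatrix id e := by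
    funext l' T
    ext M' x
    simp [pathTensor, e, Matrix.mul_apply, Fintype.sum_prod_type, Matrix.one_apply]
  rw [hrep, htensor]
  exact (h.comp hC).reindex e

theorem isDecomposition_pathTensor (hC : IsCG σ (fun g => (R g : Matrix ι ι ℂ)) m C)
    (hD : IsCG σ (conjRep R) (fun l l' => m l' l) D) :
    ∀ (n : ℕ) (q : Fin n → Query),
      IsDecomposition σ (tensorRep R q) (IrrepPath m n q) (pathTensor C D n q)
  | 0, q => isDecomposition_pathTensor_zero q
  | n + 1, q => isDecomposition_pathTensor_succ (isCG_stepTensor hC hD _)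
      (isDecomposition_pathTensor hC hD n (Fin.init q))

end Paths

section UnitaryKernels

variable {J : Type*} {K : J → J → ℂ}

/-- `K` is an infinite matrix with finitely supported orthonormal columns; `K j i` is the entry in
row `j` and column `i`. -/
def HasOrthonormalColumns (K : J → J → ℂ) : Prop :=
  ∃ s : J → Finset J, (∀ i, ∀ j ∉ s i, K j i = 0) ∧
    (∀ i, ∑ j ∈ s i, conj (K j i) * K j i = 1) ∧
    ∀ i i', i ≠ i' → ∑ j ∈ s i, conj (K j i) * K j i' = 0

theorem HasOrthonormalColumns.comp_equiv (h : HasOrthonormalColumns K) (e : J ≃ J) :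
    HasOrthonormalColumns fun j i => K (e j) (e i) := by
  obtain ⟨s, hsupp, hnorm, horth⟩ := h
  refine ⟨fun i => (s (e i)).map e.symm.toEmbedding, fun i j hj => hsupp _ _ fun hm => hj ?_,
    fun i => ?_, fun i i' hne => ?_⟩
  · exact Finset.mem_map.2 ⟨e j, hm, e.symm_apply_apply j⟩
  · simpa using hnorm (e i)
  · simpa using horth (e i) (e i') (e.injective.ne hne)

theorem HasOrthonormalColumns.conj (h : HasOrthonormalColumns K) :
    HasOrthonormalColumns fun j i => conj (K j i) := by
  obtain ⟨s, hsupp, hnorm, horth⟩ := h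
  refine ⟨s, fun i j hj => by simp only [hsupp i j hj, map_zero], fun i => ?_,
    fun i i' hne => ?_⟩
  · simpa only [map_sum, map_mul, map_one] using congrArg (starRingEnd ℂ) (hnorm i)
  · simpa only [map_sum, map_mul, map_zero] using congrArg (starRingEnd ℂ) (horth i i' hne)

variable {H : Type*} [NormedAddCommGroup H] [InnerProductSpace ℂ H] (e : HilbertBasis J ℂ H)

theorem eq_of_forall_inner_hilbertBasis_eq {f g : H} (h : ∀ j, ⟪e j, f⟫_ℂ = ⟪e j, g⟫_ℂ) :
    f = g := by
  apply e.repr.injective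
  ext j
  rw [e.repr_apply_apply, e.repr_apply_apply, h]

theorem HasOrthonormalColumns.exists_orthonormal (h : HasOrthonormalColumns K) :
    ∃ v : J → H, Orthonormal ℂ v ∧ ∀ i j, ⟪e j, v i⟫_ℂ = K j i := by
  classical
  obtain ⟨s, hsupp, hnorm, horth⟩ := h
  let v : J → H := fun i => ∑ j ∈ s i, K j i • e j
  have hev : ∀ i j, ⟪e j, v i⟫_ℂ = K j i := fun i j => by
    simp only [v, inner_sum, inner_smul_right, orthonormal_iff_ite.1 e.orthonormal, mul_ite,
      mul_one, mul_zero, Finset.sum_ite_eq]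
    split_ifs with hj
    · rfl
    · exact (hsupp i j hj).symm
  refine ⟨v, orthonormal_iff_ite.2 fun i i' => ?_, hev⟩
  have hinner : ⟪v i, v i'⟫_ℂ = ∑ j ∈ s i, conj (K j i) * K j i' := by
    rw [show v i = ∑ j ∈ s i, K j i • e j from rfl, sum_inner]
    simp only [inner_smul_left, hev]
  rw [hinner]
  split_ifs with hi
  · subst hi
    exact hnorm i
  · exact horth i i' hi

theorem HasOrthonormalColumns.topologicalClosure_span_eq_top
    (h : HasOrthonormalColumns fun i j => K j i) {v : J → H}
    (hv : ∀ i j, ⟪e j, v i⟫_ℂ = K j i) :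
    (Submodule.span ℂ (Set.range v)).topologicalClosure = ⊤ := by
  classical
  obtain ⟨t, -, hnorm, horth⟩ := h
  rw [eq_top_iff, ← e.dense_span]
  refine Submodule.topologicalClosure_mono (Submodule.span_le.2 ?_)
  rintro _ ⟨j, rfl⟩
  have hej : e j = ∑ i ∈ t j, conj (K j i) • v i := by
    refine eq_of_forall_inner_hilbertBasis_eq e fun j' => ?_
    simp only [inner_sum, inner_smul_right, hv, orthonormal_iff_ite.1 e.orthonormal]
    split_ifs with hj
    · subst hj
      exact (hnorm _).symm
    · exact (horth j j' (Ne.symm hj)).symm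
  rw [hej]
  exact Submodule.sum_mem _ fun i _ => Submodule.smul_mem _ _ (Submodule.subset_span ⟨i, rfl⟩)

variable [CompleteSpace H]

theorem exists_unitary_of_hasOrthonormalColumns (hcol : HasOrthonormalColumns K)
    (hrow : HasOrthonormalColumns fun i j => K j i) :
    ∃ U : unitary (H →L[ℂ] H), ∀ i j, ⟪e j, (U : H →L[ℂ] H) (e i)⟫_ℂ = K j i := by
  obtain ⟨v, hv, hev⟩ := hcol.exists_orthonormal e
  have hspan := hrow.topologicalClosure_span_eq_top e hev
  classical
  let b := HilbertBasis.mk hv hspan.ge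
  refine ⟨Unitary.linearIsometryEquiv.symm (e.repr.trans b.repr.symm), fun i j => ?_⟩
  have hb : b.repr.symm (e.repr (e i)) = v i := by
    rw [e.repr_self, b.repr_symm_single]
    exact congrFun (HilbertBasis.coe_mk hv hspan.ge) i
  exact (congrArg (inner ℂ (e j)) hb).trans (hev i j)

theorem unitary_eq_of_forall_inner_hilbertBasis_eq {U V : unitary (H →L[ℂ] H)}
    (h : ∀ i j, ⟪e j, (U : H →L[ℂ] H) (e i)⟫_ℂ = ⟪e j, (V : H →L[ℂ] H) (e i)⟫_ℂ) : U = V := by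
  apply Subtype.ext
  refine ContinuousLinearMap.ext_on (s := Set.range e) ?_ ?_
  · exact Submodule.dense_iff_topologicalClosure_eq_top.2 e.dense_span
  · rintro _ ⟨i, rfl⟩
    exact eq_of_forall_inner_hilbertBasis_eq e (h i)

end UnitaryKernels

section Oracles

variable {G : Type*} [Group G] [TopologicalSpace G] {σ : IrrepBasis G}

theorem ket_eq_single [DecidableEq (MemIdx σ)] (a : MemIdx σ) :
    ket a = lp.single (E := fun _ : MemIdx σ => ℂ) 2 a (1 : ℂ) := by
  rw [ket]
  congr!

theorem ket_apply (a b : MemIdx σ) [Decidable (b = a)] : ket a b = if b = a then 1 else 0 := by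
  classical
  rw [ket_eq_single, lp.single_apply, Pi.single_apply]
  congr!

theorem inner_ket (a : MemIdx σ) (f : Mem σ) : ⟪ket a, f⟫_ℂ = f a := by
  classical
  rw [ket_eq_single, lp.inner_single_left (𝕜 := ℂ) (G := fun _ : MemIdx σ => ℂ)]
  simp

variable {ι : Type*} [Fintype ι]

/-- The basis vector `|l, M, M̄⟩|x⟩` of the joint space. -/
def jointKet (σ : IrrepBasis G) (ι : Type*) [Fintype ι] (p : MemIdx σ × ι) : Joint σ ι :=
  ContinuousLinearMap.adjoint (bra σ p.2) (ket p.1)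

theorem inner_jointKet (p : MemIdx σ × ι) (f : Joint σ ι) :
    ⟪jointKet σ ι p, f⟫_ℂ = f p.2 p.1 := by
  rw [jointKet, ContinuousLinearMap.adjoint_inner_left, inner_ket]
  rfl

theorem jointKet_eq_toLp_single [DecidableEq ι] (p : MemIdx σ × ι) :
    jointKet σ ι p = WithLp.toLp 2 (Pi.single p.2 (ket p.1)) := by
  refine ext_inner_right ℂ fun f => ?_
  rw [jointKet, ContinuousLinearMap.adjoint_inner_left, PiLp.inner_apply,
    Finset.sum_eq_single p.2]
  · simp [bra]
  · intro y _ hy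
    simp [Pi.single_eq_of_ne hy]
  · simp

theorem jointKet_apply (p r : MemIdx σ × ι) [Decidable (r = p)] :
    jointKet σ ι p r.2 r.1 = if r = p then 1 else 0 := by
  classical
  rw [jointKet_eq_toLp_single, PiLp.toLp_apply]
  obtain ⟨a, x⟩ := p
  obtain ⟨b, y⟩ := r
  by_cases hxy : y = x
  · subst hxy
    rw [Pi.single_eq_same, ket_apply]
    simp
  · rw [Pi.single_eq_of_ne hxy, if_neg fun h => hxy (Prod.ext_iff.1 h).2]
    rfl

/-- The Hilbert basis `|l, M, M̄⟩|x⟩` of the joint space. -/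
def jointBasis (σ : IrrepBasis G) (ι : Type*) [Fintype ι] :
    HilbertBasis (MemIdx σ × ι) ℂ (Joint σ ι) :=
  HilbertBasis.mkOfOrthogonalEqBot (v := jointKet σ ι)
    (by
      classical
      rw [orthonormal_iff_ite]
      intro p r
      rw [inner_jointKet, jointKet_apply])
    (by
      rw [Submodule.eq_bot_iff]
      intro f hf
      rw [Submodule.mem_orthogonal] at hf
      ext x a
      have hfa := hf (jointKet σ ι (a, x)) (Submodule.subset_span ⟨_, rfl⟩)
      rwa [inner_jointKet] at hfa)

theorem inner_ket_block (X : Joint σ ι →L[ℂ] Joint σ ι) (a b : MemIdx σ) (x y : ι) :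
    ⟪ket b, block X y x (ket a)⟫_ℂ = ⟪jointBasis σ ι (b, y), X (jointBasis σ ι (a, x))⟫_ℂ := by
  rw [jointBasis, HilbertBasis.coe_mkOfOrthogonalEqBot, jointKet,
    ContinuousLinearMap.adjoint_inner_left]
  rfl

theorem sum_sum_mul_mul_sum_mul {α β γ δ : Type*} [Fintype α] [Fintype β] [Fintype γ] [Fintype δ]
    (a : γ → α → ℂ) (b : γ → β → ℂ) (z : δ → α → ℂ) (w : δ → β → ℂ) :
    ∑ M, ∑ N, (∑ T, a T M * b T N) * ∑ i, z i M * w i N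
      = ∑ T, ∑ i, (∑ M, a T M * z i M) * ∑ N, b T N * w i N := by
  simp only [Finset.sum_mul_sum]
  calc ∑ M, ∑ N, ∑ T, ∑ i, a T M * b T N * (z i M * w i N)
      = ∑ p : α × β, ∑ r : γ × δ, a r.1 p.1 * b r.1 p.2 * (z r.2 p.1 * w r.2 p.2) := by
        simp only [Fintype.sum_prod_type]
    _ = ∑ r : γ × δ, ∑ p : α × β, a r.1 p.1 * b r.1 p.2 * (z r.2 p.1 * w r.2 p.2) :=
        Finset.sum_comm
    _ = _ := by
        simp only [Fintype.sum_prod_type, mul_mul_mul_comm]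

variable {m : UDual G → UDual G → ℕ}

theorem sum_conj_kernel_mul_kernel (X : CGTensor σ ι m) (Y : CGTensor σ ι fun l l' => m l' l)
    {l l₁ : UDual G} (l' : UDual G) (M N : Fin (σ.d l)) (x : ι) (M₁ N₁ : Fin (σ.d l₁)) (x₁ : ι) :
    ∑ M', ∑ p : Fin (σ.d l') × ι, conj (kernel X Y .forward ⟨l, M, N⟩ x ⟨l', M', p.1⟩ p.2) *
        kernel X Y .forward ⟨l₁, M₁, N₁⟩ x₁ ⟨l', M', p.1⟩ p.2
      = ∑ i, ∑ j, ((X l l' i)ᴴ * X l₁ l' j) (M, x) (M₁, x₁) *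
          (Y l' l₁ j * (Y l' l i)ᴴ) N₁ N := by
  simp only [kernel, map_sum, map_mul]
  rw [sum_sum_mul_mul_sum_mul (fun i M' => conj (X l l' i M' (M, x)))
    (fun i p => conj (Y l' l i N p))]
  simp only [Matrix.mul_apply, Matrix.conjTranspose_apply, RCLike.star_def, mul_comm]

variable [DecidableEq ι] {ρ τ : G → Matrix ι ι ℂ} {X : CGTensor σ ι m}
  {Y : CGTensor σ ι fun l l' => m l' l}

theorem sum_conj_kernel_mul_kernel_self (hX : IsCG σ ρ m X)
    (hY : IsCG σ τ (fun l l' => m l' l) Y) {l : UDual G} {L : Finset (UDual G)}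
    (hL : ∀ l' ∉ L, IsEmpty (Fin (m l l'))) (M N M₁ N₁ : Fin (σ.d l)) (x x₁ : ι) :
    ∑ l' ∈ L, ∑ i, ∑ j, ((X l l' i)ᴴ * X l l' j) (M, x) (M₁, x₁) *
        (Y l' l j * (Y l' l i)ᴴ) N₁ N
      = (1 : Matrix (Fin (σ.d l) × ι) (Fin (σ.d l) × ι) ℂ) (M, x) (M₁, x₁) *
        (1 : Matrix (Fin (σ.d l)) (Fin (σ.d l)) ℂ) N₁ N := by
  rw [← (hX l).complete, finsum_sigma_eq_sum hL]
  simp only [Matrix.sum_apply, Finset.sum_mul]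
  refine Finset.sum_congr rfl fun l' _ => Finset.sum_congr rfl fun i _ => ?_
  rw [Finset.sum_eq_single_of_mem i (Finset.mem_univ i), (hY l').norm_block]
  intro j _ hj
  rw [(hY l').orth_mult _ _ _ hj, Matrix.zero_apply, mul_zero]

theorem hasOrthonormalColumns_kernel_forward (hX : IsCG σ ρ m X)
    (hY : IsCG σ τ (fun l l' => m l' l) Y) :
    HasOrthonormalColumns fun j i : MemIdx σ × ι => kernel X Y .forward i.1 i.2 j.1 j.2 := by
  choose L hL using fun l => exists_finset_isEmpty (hX l).finite
  have hsum : ∀ (l : UDual G) (M N : Fin (σ.d l)) (x : ι) (l₁ : UDual G) (M₁ N₁ : Fin (σ.d l₁))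
      (x₁ : ι), ∑ j ∈ ((L l).sigma fun _ => Finset.univ) ×ˢ (Finset.univ : Finset ι),
        conj (kernel X Y .forward ⟨l, M, N⟩ x j.1 j.2) * kernel X Y .forward ⟨l₁, M₁, N₁⟩ x₁ j.1 j.2
      = ∑ l' ∈ L l, ∑ i, ∑ j, ((X l l' i)ᴴ * X l₁ l' j) (M, x) (M₁, x₁) *
          (Y l' l₁ j * (Y l' l i)ᴴ) N₁ N := fun l M N x l₁ M₁ N₁ x₁ => by
    rw [Finset.sum_product, Finset.sum_sigma]
    refine Finset.sum_congr rfl fun l' _ => ?_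
    rw [← sum_conj_kernel_mul_kernel]
    simp only [Fintype.sum_prod_type]
  refine ⟨fun i => ((L i.1.1).sigma fun _ => Finset.univ) ×ˢ Finset.univ, ?_, ?_, ?_⟩
  · rintro ⟨⟨l, M, N⟩, x⟩ ⟨⟨l', M', N'⟩, y⟩ hj
    have : IsEmpty (Fin (m l l')) := hL l l' fun h => hj (by simpa using h)
    simp [kernel]
  · rintro ⟨⟨l, M, N⟩, x⟩
    rw [hsum, sum_conj_kernel_mul_kernel_self hX hY (hL l), Matrix.one_apply_eq,
      Matrix.one_apply_eq, mul_one]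
  · rintro ⟨⟨l, M, N⟩, x⟩ ⟨⟨l₁, M₁, N₁⟩, x₁⟩ hne
    rw [hsum]
    by_cases hl : l = l₁
    · subst hl
      rw [sum_conj_kernel_mul_kernel_self hX hY (hL l)]
      by_cases hN : N₁ = N
      · subst hN
        rw [Matrix.one_apply_ne fun hMx => hne ?_, zero_mul]
        obtain ⟨rfl, rfl⟩ := Prod.mk.inj hMx
        rfl
      · rw [Matrix.one_apply_ne hN, mul_zero]
    · refine Finset.sum_eq_zero fun l' _ => Finset.sum_eq_zero fun i _ =>
        Finset.sum_eq_zero fun j _ => ?_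
      rw [(hY l').orth_irrep _ _ _ _ (Ne.symm hl), Matrix.zero_apply, mul_zero]

section Symmetries

/-- Exchange of the registers of `V_l` and its conjugate. -/
def swapMem (σ : IrrepBasis G) : MemIdx σ ≃ MemIdx σ :=
  Equiv.sigmaCongrRight fun _ => Equiv.prodComm _ _

variable {ι : Type*} (C : CGTensor σ ι m) (D : CGTensor σ ι fun l l' => m l' l) (a b : MemIdx σ)
  (x y : ι)

theorem kernel_conjugate : kernel C D .conjugate a x b y = kernel D C .forward a x b y :=
  rfl

theorem kernel_transpose : kernel C D .transpose a x b y
    = conj (kernel C D .forward (swapMem σ a) x (swapMem σ b) y) := by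
  obtain ⟨l, M, N⟩ := a
  obtain ⟨l', M', N'⟩ := b
  simp only [kernel, ← map_mul, ← map_sum]
  rfl

theorem kernel_inverse : kernel C D .inverse a x b y
    = conj (kernel D C .forward (swapMem σ a) x (swapMem σ b) y) :=
  kernel_transpose D C a b x y

theorem kernel_forward_swap : kernel C D .forward a x b y
    = kernel D C .forward (swapMem σ b) y (swapMem σ a) x :=
  Finset.sum_congr rfl fun _ _ => mul_comm _ _

end Symmetries

theorem hasOrthonormalColumns_kernel_forward_swap (hX : IsCG σ ρ m X)
    (hY : IsCG σ τ (fun l l' => m l' l) Y) :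
    HasOrthonormalColumns fun i j : MemIdx σ × ι => kernel X Y .forward i.1 i.2 j.1 j.2 := by
  simp only [kernel_forward_swap X Y]
  exact (hasOrthonormalColumns_kernel_forward hY hX).comp_equiv
    ((swapMem σ).prodCongr (Equiv.refl ι))

theorem hasOrthonormalColumns_kernel (hX : IsCG σ ρ m X) (hY : IsCG σ τ (fun l l' => m l' l) Y)
    (q : Query) :
    HasOrthonormalColumns (fun j i : MemIdx σ × ι => kernel X Y q i.1 i.2 j.1 j.2) ∧
      HasOrthonormalColumns fun i j : MemIdx σ × ι => kernel X Y q i.1 i.2 j.1 j.2 := by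
  have hXY := hasOrthonormalColumns_kernel_forward hX hY
  have hYX := hasOrthonormalColumns_kernel_forward hY hX
  have hXY' := hasOrthonormalColumns_kernel_forward_swap hX hY
  have hYX' := hasOrthonormalColumns_kernel_forward_swap hY hX
  let e := (swapMem σ).prodCongr (Equiv.refl ι)
  cases q with
  | forward => exact ⟨hXY, hXY'⟩
  | conjugate =>
    simp only [kernel_conjugate]
    exact ⟨hYX, hYX'⟩
  | transpose =>
    simp only [kernel_transpose]
    exact ⟨(hXY.comp_equiv e).conj, (hXY'.comp_equiv e).conj⟩
  | inverse =>
    simp only [kernel_inverse]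
    exact ⟨(hYX.comp_equiv e).conj, (hYX'.comp_equiv e).conj⟩

theorem existsUnique_oracle (hX : IsCG σ ρ m X) (hY : IsCG σ τ (fun l l' => m l' l) Y) :
    ∃! O : Query → unitary (Joint σ ι →L[ℂ] Joint σ ι), ∀ q, IsOracle X Y q (O q) := by
  choose O hO using fun q => exists_unitary_of_hasOrthonormalColumns (jointBasis σ ι)
    (hasOrthonormalColumns_kernel hX hY q).1 (hasOrthonormalColumns_kernel hX hY q).2
  refine ⟨O, fun q a x b y => ?_, fun O' hO' => ?_⟩
  · rw [inner_ket_block, hO]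
  · funext q
    refine unitary_eq_of_forall_inner_hilbertBasis_eq (jointBasis σ ι) ?_
    rintro ⟨a, x⟩ ⟨b, y⟩
    rw [hO, ← inner_ket_block, hO' q a x b y]

end Oracles

section Memory

variable {G : Type*} [Group G] [TopologicalSpace G] {σ : IrrepBasis G}

theorem eq_sum_smul_ket {L : Finset (UDual G)} {f : Mem σ}
    (hf : ∀ l ∉ L, ∀ M N, f ⟨l, M, N⟩ = 0) :
    f = ∑ a ∈ L.sigma fun _ => Finset.univ, f a • ket a := by
  classical
  have hsum : HasSum (fun a : MemIdx σ => f a • ket a) f := by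
    refine (lp.hasSum_single (E := fun _ : MemIdx σ => ℂ) (p := 2) ENNReal.ofNat_ne_top f).congr_fun
      fun a => ?_
    rw [ket_eq_single, ← lp.single_smul, smul_eq_mul, mul_one]
  refine hsum.unique (hasSum_sum_of_ne_finset_zero ?_)
  rintro ⟨l, M, N⟩ ha
  rw [hf l (fun hl => ha (by simpa using hl)), zero_smul]

theorem hasTrace_rankOne (f f' : Mem σ) :
    HasTrace (InnerProductSpace.rankOne ℂ f f') ⟪f', f⟫_ℂ := by
  refine (lp.hasSum_inner f' f).congr_fun fun a => ?_
  rw [InnerProductSpace.rankOne_apply, inner_smul_right, inner_ket, ← inner_conj_symm, inner_ket,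
    RCLike.inner_apply, mul_comm]

theorem inner_eq_sum {L : Finset (UDual G)} {f : Mem σ} (hf : ∀ l ∉ L, ∀ M N, f ⟨l, M, N⟩ = 0)
    (f' : Mem σ) :
    ⟪f', f⟫_ℂ = ∑ l ∈ L, ∑ M, ∑ N, f ⟨l, M, N⟩ * conj (f' ⟨l, M, N⟩) := by
  have hket : ∀ a, ⟪f', ket a⟫_ℂ = conj (f' a) := fun a => by rw [← inner_conj_symm, inner_ket]
  conv_lhs => rw [eq_sum_smul_ket hf]
  simp only [inner_sum, inner_smul_right, hket, Finset.sum_sigma, Fintype.sum_prod_type]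

theorem apply_eq_sum_inner_ket {L : Finset (UDual G)} {f : Mem σ}
    (hf : ∀ l ∉ L, ∀ M N, f ⟨l, M, N⟩ = 0) (A : Mem σ →L[ℂ] Mem σ) (b : MemIdx σ) :
    A f b = ∑ l ∈ L, ∑ M, ∑ N, f ⟨l, M, N⟩ * ⟪ket b, A (ket ⟨l, M, N⟩)⟫_ℂ := by
  rw [← inner_ket]
  conv_lhs => rw [eq_sum_smul_ket hf]
  simp only [map_sum, map_smul, inner_sum, inner_smul_right, Finset.sum_sigma,
    Fintype.sum_prod_type]

variable {ι : Type*} [Fintype ι]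

theorem block_star (U : Joint σ ι →L[ℂ] Joint σ ι) (x y : ι) :
    block (star U) x y = star (block U y x) := by
  rw [ContinuousLinearMap.star_eq_adjoint, ContinuousLinearMap.star_eq_adjoint, block, block,
    ContinuousLinearMap.adjoint_comp, ContinuousLinearMap.adjoint_comp,
    ContinuousLinearMap.adjoint_adjoint, ContinuousLinearMap.comp_assoc]

variable (O : Query → unitary (Joint σ ι →L[ℂ] Joint σ ι))

/-- The unnormalized memory state `O_{(y_n,x_n)} ⋯ O_{(y_1,x_1)} |∅⟩` left by queries with inputs
`x` and outputs `y`. -/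
def memState {n : ℕ} (q : Fin n → Query) (x y : Fin n → ι) : Mem σ :=
  (List.ofFn fun k => block (O (q k) : Joint σ ι →L[ℂ] Joint σ ι) (y k) (x k)).reverse.prod
    (vacuum σ)

theorem memState_zero (q : Fin 0 → Query) (x y : Fin 0 → ι) : memState O q x y = vacuum σ := by
  rw [memState, List.ofFn_zero]
  rfl

theorem memState_succ {n : ℕ} (q : Fin (n + 1) → Query) (x y : Fin (n + 1) → ι) :
    memState O q x y = block (O (q (Fin.last n)) : Joint σ ι →L[ℂ] Joint σ ι) (y (Fin.last n))
      (x (Fin.last n)) (memState O (Fin.init q) (Fin.init x) (Fin.init y)) := by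
  rw [memState, List.ofFn_succ', List.concat_eq_append, List.reverse_append,
    List.reverse_singleton, List.singleton_append, List.prod_cons]
  rfl

theorem memoryOp_eq_rankOne {n : ℕ} (q : Fin n → Query) (x y x' y' : Fin n → ι) :
    memoryOp O q x y x' y'
      = InnerProductSpace.rankOne ℂ (memState O q x y) (memState O q x' y') := by
  have hstar : (List.ofFn fun k =>
      block (star (O (q k)) : Joint σ ι →L[ℂ] Joint σ ι) (x' k) (y' k)).prod
      = star (List.ofFn fun k =>
        block (O (q k) : Joint σ ι →L[ℂ] Joint σ ι) (y' k) (x' k)).reverse.prod := by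
    refine .trans ?_ (unop_map_list_prod starMulEquiv _).symm
    simp only [block_star, List.map_reverse, List.reverse_reverse, List.map_ofFn]
    rfl
  rw [memoryOp, hstar, ContinuousLinearMap.star_eq_adjoint, ContinuousLinearMap.mul_def,
    ContinuousLinearMap.mul_def, InnerProductSpace.comp_rankOne, InnerProductSpace.rankOne_comp,
    ContinuousLinearMap.adjoint_adjoint]
  rfl

theorem hasTrace_memoryOp {n : ℕ} (q : Fin n → Query) (x y x' y' : Fin n → ι)
    {L : Finset (UDual G)} (hL : ∀ l ∉ L, ∀ M N, memState O q x y ⟨l, M, N⟩ = 0) :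
    HasTrace (memoryOp O q x y x' y') (∑ l ∈ L, ∑ M, ∑ N,
      memState O q x y ⟨l, M, N⟩ * conj (memState O q x' y' ⟨l, M, N⟩)) := by
  rw [memoryOp_eq_rankOne, ← inner_eq_sum hL]
  exact hasTrace_rankOne _ _

end Memory

section PathState

variable {G : Type*} [Group G] [TopologicalSpace G] {σ : IrrepBasis G}

theorem inv_sqrt_d_mul_dualScale (σ : IrrepBasis G) (l l' : UDual G) :
    ((√(σ.d l))⁻¹ : ℂ) * dualScale σ l' l = ((√(σ.d l'))⁻¹ : ℂ) := by
  have hl : √(σ.d l : ℝ) ≠ 0 := (Real.sqrt_pos.2 (Nat.cast_pos.2 (σ.d_pos l))).ne'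
  rw [dualScale, Real.sqrt_div (Nat.cast_nonneg _), Complex.ofReal_div,
    inv_mul_eq_div, div_right_comm, div_self (Complex.ofReal_ne_zero.2 hl), one_div]

theorem inv_sqrt_d_mul_self (σ : IrrepBasis G) (l : UDual G) :
    ((√(σ.d l))⁻¹ : ℂ) * ((√(σ.d l))⁻¹ : ℂ) = (σ.d l : ℂ)⁻¹ := by
  rw [← mul_inv, ← Complex.ofReal_mul, Real.mul_self_sqrt (Nat.cast_nonneg _),
    Complex.ofReal_natCast]

theorem vacuum_apply (l : UDual G) (M N : Fin (σ.d l)) [Decidable (l = triv G)] :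
    vacuum σ ⟨l, M, N⟩ = if l = triv G then 1 else 0 := by
  classical
  rw [vacuum, ket_apply]
  by_cases h : l = triv G
  · subst h
    rw [if_pos rfl, if_pos]
    rw [Subsingleton.elim M ⟨0, σ.d_pos _⟩, Subsingleton.elim N ⟨0, σ.d_pos _⟩]
  · rw [if_neg h, if_neg fun h' => h (congrArg Sigma.fst h')]

variable {m : UDual G → UDual G → ℕ}

section Kernel

variable {ι : Type*} (C : CGTensor σ ι m)

theorem kernel_dualTensor_forward (l l' : UDual G) (M N : Fin (σ.d l))
    (M' N' : Fin (σ.d l')) (x y : ι) :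
    kernel C (dualTensor C) .forward ⟨l, M, N⟩ x ⟨l', M', N'⟩ y = (dualScale σ l' l : ℂ) *
      ∑ i, C l l' i M' (M, x) * conj (C l l' i N' (N, y)) := by
  simp only [kernel, dualTensor, bend, Matrix.smul_apply, Matrix.of_apply, smul_eq_mul,
    Finset.mul_sum, mul_left_comm]

theorem kernel_dualTensor_transpose (l l' : UDual G) (M N : Fin (σ.d l))
    (M' N' : Fin (σ.d l')) (x y : ι) :
    kernel C (dualTensor C) .transpose ⟨l, M, N⟩ x ⟨l', M', N'⟩ y = (dualScale σ l' l : ℂ) *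
      ∑ i, C l l' i M' (M, y) * conj (C l l' i N' (N, x)) := by
  rw [kernel_transpose]
  refine (congrArg conj (kernel_dualTensor_forward C l l' N M N' M' x y)).trans ?_
  simp only [map_mul, map_sum, Complex.conj_ofReal, Complex.conj_conj, mul_comm (conj _)]

theorem kernel_eq_sum_stepTensor (q : Query) (l l' : UDual G) (M N : Fin (σ.d l))
    (M' N' : Fin (σ.d l')) (x y : ι) :
    kernel C (dualTensor C) q ⟨l, M, N⟩ x ⟨l', M', N'⟩ y = (dualScale σ l' l : ℂ) *
      ∑ i, stepTensor C (dualTensor C) q l l' i M' (M, q.col x y) *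
        conj (stepTensor C (dualTensor C) q l l' i N' (N, q.row x y)) := by
  have hC := dualTensor_dualTensor C
  cases q with
  | forward => exact kernel_dualTensor_forward C l l' M N M' N' x y
  | conjugate =>
    have := kernel_dualTensor_forward (dualTensor C) l l' M N M' N' x y
    rwa [hC] at this
  | transpose => exact kernel_dualTensor_transpose C l l' M N M' N' x y
  | inverse =>
    have := kernel_dualTensor_transpose (dualTensor C) l l' M N M' N' x y
    rwa [hC] at this

end Kernel

variable {ι : Type*} [Fintype ι] {C : CGTensor σ ι m}
  {O : Query → unitary (Joint σ ι →L[ℂ] Joint σ ι)}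

theorem sum_sum_smul_mul_conj {α β γ δ : Type*} [Fintype α] [Fintype β] [Fintype γ] [Fintype δ]
    (s t : ℂ) (a : γ → α → ℂ) (b : γ → β → ℂ) (z : δ → α → ℂ) (w : δ → β → ℂ) :
    ∑ M, ∑ N, (s * ∑ T, a T M * conj (b T N)) * (t * ∑ i, z i M * conj (w i N))
      = s * t * ∑ T, ∑ i, (∑ M, z i M * a T M) * conj (∑ N, w i N * b T N) := by
  have h := sum_sum_mul_mul_sum_mul a (fun T N => conj (b T N)) z (fun i N => conj (w i N))
  simp only [mul_mul_mul_comm s, ← Finset.mul_sum, h, map_sum, map_mul, mul_comm]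

theorem memState_zero_apply (q : Fin 0 → Query) (x y : Fin 0 → ι) (l : UDual G)
    (M N : Fin (σ.d l)) :
    memState O q x y ⟨l, M, N⟩ = ((√(σ.d l))⁻¹ : ℂ) * ∑ᶠ T : IrrepPath m 0 q l,
      pathTensor C (dualTensor C) 0 q l T M (fun k => (q k).col (x k) (y k)) *
        conj (pathTensor C (dualTensor C) 0 q l T N fun k => (q k).row (x k) (y k)) := by
  classical
  rw [memState_zero, vacuum_apply]
  by_cases h : l = triv G
  · subst h
    have : Unique (IrrepPath m 0 q (triv G)) := ⟨⟨⟨⟨rfl⟩⟩⟩, fun _ => rfl⟩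
    rw [if_pos rfl, finsum_unique]
    simp [pathTensor, σ.d_triv_and_mat_triv.1]
  · have : IsEmpty (IrrepPath m 0 q l) := ⟨fun T => h T.down.down⟩
    rw [if_neg h, finsum_of_isEmpty, mul_zero]

theorem memState_succ_apply {n : ℕ} {q : Fin (n + 1) → Query}
    (hO : IsOracle C (dualTensor C) (q (Fin.last n)) (O (q (Fin.last n))))
    (hfin : Finite ((l : UDual G) × IrrepPath m n (Fin.init q) l)) {x y : Fin (n + 1) → ι}
    (ih : ∀ (l : UDual G) (M N : Fin (σ.d l)),
      memState O (Fin.init q) (Fin.init x) (Fin.init y) ⟨l, M, N⟩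
        = ((√(σ.d l))⁻¹ : ℂ) * ∑ᶠ T : IrrepPath m n (Fin.init q) l,
          pathTensor C (dualTensor C) n (Fin.init q) l T M
              (Fin.init fun k => (q k).col (x k) (y k)) *
            conj (pathTensor C (dualTensor C) n (Fin.init q) l T N
              (Fin.init fun k => (q k).row (x k) (y k))))
    (l' : UDual G) (M' N' : Fin (σ.d l')) :
    memState O q x y ⟨l', M', N'⟩ = ((√(σ.d l'))⁻¹ : ℂ) * ∑ᶠ T : IrrepPath m (n + 1) q l',
      pathTensor C (dualTensor C) (n + 1) q l' T M' (fun k => (q k).col (x k) (y k)) *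
        conj (pathTensor C (dualTensor C) (n + 1) q l' T N' fun k => (q k).row (x k) (y k)) := by
  obtain ⟨L, hL⟩ := exists_finset_isEmpty hfin
  have (l : UDual G) : Fintype (IrrepPath m n (Fin.init q) l) :=
    have := Finite.of_injective (Sigma.mk l : IrrepPath m n (Fin.init q) l → _) sigma_mk_injective
    Fintype.ofFinite _
  have hsupp : ∀ l ∉ L, ∀ M N,
      memState O (Fin.init q) (Fin.init x) (Fin.init y) ⟨l, M, N⟩ = 0 := fun l hl M N => by
    have := hL l hl
    rw [ih, finsum_of_isEmpty, mul_zero]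
  have hL' : ∀ l ∉ L, IsEmpty (IrrepPath m n (Fin.init q) l ×
      Fin (stepMult m (q (Fin.last n)) l l')) := fun l hl => by
    have := hL l hl
    infer_instance
  rw [memState_succ, apply_eq_sum_inner_ket hsupp]
  refine .trans ?_ (congrArg _ (finsum_sigma_eq_sum hL' _).symm)
  rw [Finset.mul_sum]
  refine Finset.sum_congr rfl fun l _ => ?_
  simp only [hO _ _ _ _, ih, kernel_eq_sum_stepTensor, finsum_eq_sum_of_fintype]
  rw [Fintype.sum_prod_type, ← inv_sqrt_d_mul_dualScale σ l l']
  exact sum_sum_smul_mul_conj _ _ _ _ _ _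

variable [DecidableEq ι] {R : G →* Matrix.unitaryGroup ι ℂ}

theorem memState_apply (hC : IsCG σ (fun g => (R g : Matrix ι ι ℂ)) m C)
    (hD : IsCG σ (conjRep R) (fun l l' => m l' l) (dualTensor C))
    (hO : ∀ q, IsOracle C (dualTensor C) q (O q)) :
    ∀ (n : ℕ) (q : Fin n → Query) (x y : Fin n → ι) (l : UDual G) (M N : Fin (σ.d l)),
      memState O q x y ⟨l, M, N⟩ = ((√(σ.d l))⁻¹ : ℂ) * ∑ᶠ T : IrrepPath m n q l,
        pathTensor C (dualTensor C) n q l T M (fun k => (q k).col (x k) (y k)) *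
          conj (pathTensor C (dualTensor C) n q l T N fun k => (q k).row (x k) (y k))
  | 0, q, x, y => memState_zero_apply q x y
  | n + 1, q, x, y => memState_succ_apply (hO _)
      (isDecomposition_pathTensor hC hD n (Fin.init q)).finite
      (memState_apply hC hD hO n (Fin.init q) (Fin.init x) (Fin.init y))

theorem hasTrace_memoryOp_pathTensor (hC : IsCG σ (fun g => (R g : Matrix ι ι ℂ)) m C)
    (hD : IsCG σ (conjRep R) (fun l l' => m l' l) (dualTensor C))
    (hO : ∀ q, IsOracle C (dualTensor C) q (O q)) {n : ℕ} (q : Fin n → Query)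
    (x y x' y' : Fin n → ι) :
    HasTrace (memoryOp O q x y x' y') (∑ᶠ l : UDual G, (σ.d l : ℂ)⁻¹ *
      ∑ᶠ T : IrrepPath m n q l, ∑ᶠ S : IrrepPath m n q l,
        matUnit (pathTensor C (dualTensor C) n q) l T S (fun k => (q k).col (x' k) (y' k))
          (fun k => (q k).col (x k) (y k)) *
        conj (matUnit (pathTensor C (dualTensor C) n q) l T S
          (fun k => (q k).row (x' k) (y' k)) (fun k => (q k).row (x k) (y k)))) := by
  have hP := isDecomposition_pathTensor hC hD n q
  obtain ⟨L, hL⟩ := exists_finset_isEmpty hP.finite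
  have (l : UDual G) : Fintype (IrrepPath m n q l) :=
    have := hP.finite_mult l
    Fintype.ofFinite _
  have hψ := memState_apply hC hD hO n q
  have hsupp : ∀ l ∉ L, ∀ M N, memState O q x y ⟨l, M, N⟩ = 0 := fun l hl M N => by
    have := hL l hl
    rw [hψ, finsum_of_isEmpty, mul_zero]
  convert hasTrace_memoryOp O q x y x' y' hsupp using 1
  rw [finsum_eq_sum_of_forall_notMem (L := L) fun l hl => by
    have := hL l hl
    rw [finsum_of_isEmpty, mul_zero]]
  refine Finset.sum_congr rfl fun l _ => ?_
  simp only [hψ, finsum_eq_sum_of_fintype, matUnit, Matrix.mul_apply, Matrix.conjTranspose_apply]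
  rw [Finset.sum_comm, ← inv_sqrt_d_mul_self]
  refine (sum_sum_smul_mul_conj _ _ _ _ _ _).symm.trans ?_
  simp only [map_mul, map_sum, map_inv₀, Complex.conj_ofReal, RCLike.star_def]

end PathState

section HaarAverage

variable {G : Type*} [Group G] {ι : Type*} [Fintype ι] [DecidableEq ι]

theorem Query.op_apply (R : G →* Matrix.unitaryGroup ι ℂ) (q : Query) (g : G) (x y : ι) :
    q.op (R g : Matrix ι ι ℂ) y x = q.base R g (q.row x y) (q.col x y) := by
  cases q <;> rfl

theorem prod_op_mul_prod_op_conjTranspose (R : G →* Matrix.unitaryGroup ι ℂ) {n : ℕ}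
    (q : Fin n → Query) (g : G) (x y x' y' : Fin n → ι) :
    (∏ k, (q k).op (R g : Matrix ι ι ℂ) (y k) (x k)) *
      ∏ k, ((q k).op (R g : Matrix ι ι ℂ))ᴴ (x' k) (y' k)
    = tensorRep R q g (fun k => (q k).row (x k) (y k)) (fun k => (q k).col (x k) (y k)) *
      conj (tensorRep R q g (fun k => (q k).row (x' k) (y' k))
        (fun k => (q k).col (x' k) (y' k))) := by
  simp only [tensorRep, Matrix.of_apply, Matrix.conjTranspose_apply, Query.op_apply, map_prod,
    RCLike.star_def]

end HaarAverage

end CompressedOracle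

end

theorem theorem1 {G : Type*} [Group G] [TopologicalSpace G] [IsTopologicalGroup G] [CompactSpace G]
    [MeasurableSpace G] [BorelSpace G] (μ : Measure G) [μ.IsHaarMeasure] [IsProbabilityMeasure μ]
    {ι : Type*} [Fintype ι] [DecidableEq ι] (R : G →* Matrix.unitaryGroup ι ℂ)
    (hR : Continuous fun g => (R g : Matrix ι ι ℂ)) (σ : IrrepBasis G) :
    -- Clebsch–Gordan transforms exist
    (∃ (m : UDual G → UDual G → ℕ) (C : CGTensor σ ι m), IsCG σ (fun g => (R g : Matrix ι ι ℂ)) m C) ∧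
    ∀ (m : UDual G → UDual G → ℕ) (C : CGTensor σ ι m),
      IsCG σ (fun g => (R g : Matrix ι ι ℂ)) m C →
      -- each has a unique dual Clebsch–Gordan transform
      (∃! D : CGTensor σ ι fun l l' => m l' l, IsDualCG σ R C D) ∧
      ∀ D : CGTensor σ ι fun l l' => m l' l, IsDualCG σ R C D →
        -- the two transforms define unitary oracles of all four types
        (∃! O : Query → unitary (Joint σ ι →L[ℂ] Joint σ ι), ∀ q, IsOracle C D q (O q)) ∧
        ∀ (n : ℕ) (q : Fin n → Query),
          -- composing the tensors along paths decomposes the tensor product representation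
          IsDecomposition σ (tensorRep R q) (IrrepPath m n q) (pathTensor C D n q) ∧
          IsCommutantMatrixUnits (tensorRep R q) (IrrepPath m n q) (matUnit (pathTensor C D n q)) ∧
          ∀ O : Query → unitary (Joint σ ι →L[ℂ] Joint σ ι), (∀ q, IsOracle C D q (O q)) →
            -- for the path basis, and for any other orthonormal basis of the multiplicity spaces
            (∀ (B : UDual G → Type*)
              (W : (l : UDual G) → B l → Matrix (Fin (σ.d l)) (Fin n → ι) ℂ),
              IsDecomposition σ (tensorRep R q) B W →
              IsCommutantMatrixUnits (tensorRep R q) B (matUnit W) ∧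
              ∀ x y x' y' : Fin n → ι,
                HasTrace (memoryOp O q x y x' y')
                  (∑ᶠ l : UDual G, (σ.d l : ℂ)⁻¹ * ∑ᶠ T : B l, ∑ᶠ S : B l,
                    matUnit W l T S (fun k => (q k).col (x' k) (y' k))
                      (fun k => (q k).col (x k) (y k)) *
                    conj (matUnit W l T S (fun k => (q k).row (x' k) (y' k))
                      (fun k => (q k).row (x k) (y k)))) ∧
                -- without the conjugation if the matrix units have real entries
                ((∀ l T S a b, (matUnit W l T S a b).im = 0) →
                  HasTrace (memoryOp O q x y x' y')
                    (∑ᶠ l : UDual G, (σ.d l : ℂ)⁻¹ * ∑ᶠ T : B l, ∑ᶠ S : B l,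
                      matUnit W l T S (fun k => (q k).col (x' k) (y' k))
                        (fun k => (q k).col (x k) (y k)) *
                      matUnit W l T S (fun k => (q k).row (x' k) (y' k))
                        (fun k => (q k).row (x k) (y k))))) ∧
            -- the trace is the Haar average
            ∀ x y x' y' : Fin n → ι,
              HasTrace (memoryOp O q x y x' y')
                (∫ g, (∏ k, (q k).op (R g : Matrix ι ι ℂ) (y k) (x k)) *
                  ∏ k, ((q k).op (R g : Matrix ι ι ℂ))ᴴ (x' k) (y' k) ∂μ) := by
  refine ⟨(IsUnitaryRep.of_hom hR).exists_isCG σ, fun m C hC => ⟨⟨dualTensor C,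
    isDualCG_dualTensor hR hC, fun D hD => hD.eq_dualTensor hC⟩, fun D hD => ?_⟩⟩
  obtain rfl := hD.eq_dualTensor hC
  refine ⟨existsUnique_oracle hC hD.isCG, fun n q => ?_⟩
  have hP := isDecomposition_pathTensor hC hD.isCG n q
  refine ⟨hP, hP.isCommutantMatrixUnits, fun O hO => ?_⟩
  have htrace : ∀ x y x' y' : Fin n → ι, HasTrace (memoryOp O q x y x' y')
      (∫ g, tensorRep R q g (fun k => (q k).row (x k) (y k)) (fun k => (q k).col (x k) (y k)) *
        conj (tensorRep R q g (fun k => (q k).row (x' k) (y' k))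
          (fun k => (q k).col (x' k) (y' k))) ∂μ) := fun x y x' y' => by
    rw [hP.integral_eq]
    exact hasTrace_memoryOp_pathTensor hC hD.isCG hO q x y x' y'
  refine ⟨fun B W hW => ⟨hW.isCommutantMatrixUnits, fun x y x' y' => ?_⟩, fun x y x' y' => ?_⟩
  · have hsum := htrace x y x' y'
    rw [hW.integral_eq] at hsum
    refine ⟨hsum, fun hreal => ?_⟩
    simpa only [Complex.conj_eq_iff_im.2 (hreal _ _ _ _ _)] using hsum
  · simp only [prod_op_mul_prod_op_conjTranspose]
    exact htrace x y x' y'
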